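/- **Theorem 4.1 (weak convergence of $\mathfrak m_{K,u}$).** Let $n\ge 1$, let $dS$ be the surface measure of the unit sphere $S^n\subset\mathbb R^{n+1}$, and for a compact convex nonempty set $K\subset\mathbb R^{n+1}$ let $h_K(x)=\max_{y\in K}x\cdot y$, $x\in S^n$, be its support function. Let $\mathcal K_e$ be the set of all such $K$ with $K=-K$, with the Hausdorff metric, and let $\mathcal K^2_{+,e}\subset\mathcal K_e$ be the set of those $K$ for which $h_K\in C^2(S^n)$ and $\nabla^2h_K+h_K\,\mathrm{Id}>0$ on $S^n$. For $u\in C^2(S^n)$ and $K\in\mathcal K_e$ with $h=h_K\in C^2(S^n)$ put $$\mathfrak m_{K,u}=U^{ij}u_iu_j\,dS,$$ where indices refer to a local orthonormal frame of $S^n$ and $U^{ij}$ is the cofactor matrix of $H_{ij}=h_{ij}+h\delta_{ij}$; thus $U^{ij}=H^{ij}\det H$, with $(H^{ij})$ the inverse of $(H_{ij})$, where $H$ is invertible. The definition of $\mathfrak m_{K,u}$ extends to all $K\in\mathcal K_e$ and $u\in C^2(S^n)$, with values in the finite Borel measures on $S^n$, in such a way that: 1. (Weak convergence.) If $u\in C^2(S^n)$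 and $K_i\in\mathcal K^2_{+,e}$ converge to $K$ in the Hausdorff metric, then the measures $\mathfrak m_{K_i,u}$ converge weakly to $\mathfrak m_{K,u}$. 2. (Total mass.) The total mass $\mathfrak m_{K,u}(S^n)$ is bounded by a constant depending only on $n$, $\|u\|_{C^2}$ and $\|h_K\|_{L^\infty}$: for all $A,B\in\mathbb R$ there is $C=C(n,A,B)$ such that $\mathfrak m_{K,u}(S^n)\le C$ for all $K\in\mathcal K_e$ and $u\in C^2(S^n)$ with $\|u\|_{C^2}\le A$ and $\|h_K\|_{L^\infty}\le B$. Moreover, every $K\in\mathcal K_e$ is the limit in the Hausdorff metric of a sequence in $\mathcal K^2_{+,e}$, so that the extension is determined by the weak convergence. -/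

import Mathlib

open MeasureTheory Filter Topology Metric
open scoped Manifold ContDiff InnerProductSpace

noncomputable section

namespace ConvexSphere

/-- The Euclidean space `ℝ^{n+1}`. -/
abbrev E (n : ℕ) := EuclideanSpace ℝ (Fin (n + 1))

/-- The unit sphere `S^n ⊂ ℝ^{n+1}`. -/
abbrev S (n : ℕ) := sphere (0 : E n) 1

variable {n : ℕ}

/-- `f ∈ C²(S^n)`. -/
def IsC2 (f : S n → ℝ) : Prop := ContMDiff (𝓡 n) 𝓘(ℝ, ℝ) 2 f

/-- The tangent space `T_x S^n = x^⊥`. -/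
abbrev T (x : S n) : Submodule ℝ (E n) := (Submodule.span ℝ {(x : E n)})ᗮ

/-- The extension of `f` from `S^n` to `ℝ^{n+1}` which is homogeneous of degree zero,
`y ↦ f (y / |y|)`. The value at the origin is irrelevant. -/
def ext0 (f : S n → ℝ) (y : E n) : ℝ :=
  if h : y = 0 then 0
  else f ⟨‖y‖⁻¹ • y, by
    have : ‖y‖ ≠ 0 := norm_ne_zero_iff.mpr h
    simp [norm_smul, this]⟩

/-- The differential `∇f(x)` on `T_x S^n` of a function `f` on the sphere. -/
def grad (f : S n → ℝ) (x : S n) : T x →L[ℝ] ℝ :=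
  (fderiv ℝ (ext0 f) (x : E n)).comp (T x).subtypeL

/-- The covariant Hessian `∇²f(x)` on `T_x S^n` for the round metric. As the degree zero
extension has no radial derivative, its Euclidean Hessian restricted to `T_x S^n` is the covariant
Hessian: for a unit tangent vector `X`, both are the second derivative of `f` along the great
circle `cos t • x + sin t • X` at `t = 0`. -/
def hess (f : S n → ℝ) (x : S n) : T x →L[ℝ] T x →L[ℝ] ℝ :=
  (fderiv ℝ (fderiv ℝ (ext0 f)) (x : E n)).bilinearComp (T x).subtypeL (T x).subtypeL

/-- The bilinear form `H = ∇²h + h Id` on `T_x S^n`. -/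
def formH (h : S n → ℝ) (x : S n) (X Y : T x) : ℝ :=
  hess h x X Y + h x * ⟪X, Y⟫_ℝ

/-- The matrix `H_{ij} = h_{ij} + h δ_{ij}` in the orthonormal frame `b` of `T_x S^n`. -/
def matH (h : S n → ℝ) {x : S n} (b : OrthonormalBasis (Fin n) ℝ (T x)) :
    Matrix (Fin n) (Fin n) ℝ :=
  Matrix.of fun i j => formH h x (b i) (b j)

/-- `U^{ij} u_i u_j` in the orthonormal frame `b`, where `U` is the cofactor matrix of `H`. -/
def cofactorIn (h u : S n → ℝ) {x : S n} (b : OrthonormalBasis (Fin n) ℝ (T x)) : ℝ :=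
  ∑ i, ∑ j, (matH h b).adjugate i j * grad u x (b i) * grad u x (b j)

/-- The function `U^{ij} u_i u_j` on `S^n`; by `cofactorDensity_eq` it does not depend on the
orthonormal frame. -/
def cofactorDensity (h u : S n → ℝ) (x : S n) : ℝ :=
  haveI : Fact (Module.finrank ℝ (E n) = n + 1) := ⟨finrank_euclideanSpace_fin⟩
  cofactorIn h u (OrthonormalBasis.fromOrthogonalSpanSingleton (𝕜 := ℝ) n
    (ne_zero_of_mem_unit_sphere x))

theorem cofactorIn_eq (h u : S n → ℝ) {x : S n} (b c : OrthonormalBasis (Fin n) ℝ (T x)) :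
    cofactorIn h u b = cofactorIn h u c := by
  have key : ∀ d : OrthonormalBasis (Fin n) ℝ (T x), cofactorIn h u d =
      (fun i => grad u x (d i)) ⬝ᵥ
        ((matH h d).adjugate.mulVec (fun i => grad u x (d i))) := by
    intro d
    simp only [cofactorIn, dotProduct, Matrix.mulVec, Finset.mul_sum]
    refine Finset.sum_congr rfl fun i _ => Finset.sum_congr rfl fun j _ => by ring
  set P : Matrix (Fin n) (Fin n) ℝ := b.toBasis.toMatrix c with hP
  have hc : ∀ j, c j = ∑ i, P i j • b i := by
    intro j
    have := b.toBasis.sum_toMatrix_smul_self (v := c) (j := j)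
    simpa using this.symm
  have hg : (fun i => grad u x (c i)) = P.transpose.mulVec (fun i => grad u x (b i)) := by
    ext j
    rw [hc j]
    simp [Matrix.mulVec, dotProduct]
  have hM : matH h c = P.transpose * matH h b * P := by
    ext i j
    simp only [matH, formH, Matrix.of_apply, Matrix.mul_apply, Matrix.transpose_apply]
    rw [hc i, hc j]
    simp only [map_sum, map_smul, _root_.sum_apply,
      _root_.smul_apply, sum_inner, inner_sum, inner_smul_left, inner_smul_right,
      smul_eq_mul, Finset.mul_sum, Finset.sum_mul]
    rw [← Finset.sum_add_distrib]
    refine Finset.sum_congr rfl fun k _ => ?_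
    rw [← Finset.sum_add_distrib]
    refine Finset.sum_congr rfl fun l _ => ?_
    simp
    ring
  have hdet : P.det * P.det = 1 := by
    have h1 := b.toMatrix_orthonormalBasis_mem_orthogonal c
    rw [Matrix.mem_orthogonalGroup_iff] at h1
    have h2 := congrArg Matrix.det h1
    simpa [Matrix.star_eq_conjTranspose, hP] using h2
  rw [key b, key c, hg, hM]
  have hadj : (P.transpose * matH h b * P).adjugate =
      P.adjugate * ((matH h b).adjugate * P.adjugate.transpose) := by
    rw [Matrix.adjugate_mul_distrib, Matrix.adjugate_mul_distrib, Matrix.adjugate_transpose]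
  have h3 : P.adjugate.transpose * P.transpose = P.det • (1 : Matrix (Fin n) (Fin n) ℝ) := by
    rw [← Matrix.transpose_mul, Matrix.mul_adjugate]
    simp
  rw [hadj, Matrix.mulVec_mulVec, Matrix.mulVec_transpose, ← Matrix.dotProduct_mulVec,
    Matrix.mulVec_mulVec, Matrix.mul_assoc, Matrix.mul_assoc, h3, ← Matrix.mul_assoc,
    Matrix.mul_adjugate]
  simp only [Matrix.mul_smul, Matrix.smul_mul, Matrix.mul_one, Matrix.one_mul, smul_smul, hdet,
    one_smul]

theorem cofactorDensity_eq (h u : S n → ℝ) {x : S n}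
    (b : OrthonormalBasis (Fin n) ℝ (T x)) : cofactorDensity h u x = cofactorIn h u b :=
  cofactorIn_eq h u _ b

/-- The support function `h_K(x) = max_{y ∈ K} x·y`, restricted to `S^n`. -/
def supp (K : ConvexBody (E n)) (x : S n) : ℝ :=
  sSup ((fun y : E n => ⟪(x : E n), y⟫_ℝ) '' (K : Set (E n)))

/-- `K ∈ 𝒦_e`: the convex body `K` is origin-symmetric. -/
def IsEven (K : ConvexBody (E n)) : Prop := ∀ y ∈ K, -y ∈ K

/-- `K ∈ 𝒦²_{+,e}`: `K` is origin-symmetric, its support function is of class `C²`, and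
`∇²h_K + h_K Id > 0` on `S^n`. -/
structure IsSmoothPosEven (K : ConvexBody (E n)) : Prop where
  even : IsEven K
  c2 : IsC2 (supp K)
  pos : ∀ (x : S n) (X : T x), X ≠ 0 → 0 < formH (supp K) x X X

/-- The surface measure `dS` on `S^n`. -/
def dS (n : ℕ) : Measure (S n) := (volume : Measure (E n)).toSphere

/-- The measure `U^{ij} u_i u_j dS`, `U` being the cofactor matrix of `H = ∇²h_K + h_K Id`
(so that `U^{ij} = H^{ij} det H` where `H` is invertible). It is meant for `h_K ∈ C²(S^n)`, when
`H ≥ 0` by convexity, so that the density is nonnegative. -/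
def cofactorMeasure (K : ConvexBody (E n)) (u : S n → ℝ) : Measure (S n) :=
  (dS n).withDensity fun x => ENNReal.ofReal (cofactorDensity (supp K) u x)

/-- The sup norm of a (bounded) function on `S^n`. -/
def supNorm (f : S n → ℝ) : ℝ := ⨆ x, |f x|

set_option maxSynthPendingDepth 3 in
/-- The norm `‖u‖_{C²} = sup |u| + sup |∇u| + sup |∇²u|`, for `u ∈ C²(S^n)`. -/
def c2Norm (u : S n → ℝ) : ℝ :=
  (⨆ x : S n, |u x|) + (⨆ x : S n, ‖grad u x‖) + (⨆ x : S n, ‖hess u x‖)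

end ConvexSphere

end

/-!
# Weak convergence of the measures `U^{ij} u_i u_j dS`

The measure is recovered from the volume of parallel bodies, which depends continuously on the body.
For a convex body `M` let `p_M` be the nearest point map, and for `ψ` continuous with compact
support in `ℝ^{n+1} ∖ {0}` put `G_M(ψ) = ∫ ψ(x - p_M(x)) dx` (`normalIntegral`). As `p_M` depends
continuously on `M` in the Hausdorff metric, so does `G_M(ψ)`, by dominated convergence
(`tendsto_normalIntegral`).
If the support function `N` of `M` is `C²` away from the origin, then `y ↦ ∇N(y) + y` is the inverse
of `x ↦ x - p_M(x)` on the complement of `M`, and so `G_M(ψ) = ∫ ψ(y) det(D²N(y) + 1) dy`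
(`IsSupportFun.integral_comp_sub_nearest`). No strict convexity is needed.

Apply this to `M = j K + L` for `j = 0, …, n`. The determinant `det(s D²h_K + D²h_L + 1)` is a
polynomial in `s` of degree at most `n`, and a fixed linear combination of its values at
`0, …, n` is the coefficient of `s^{n-1}`. In polar coordinates `y = r x`, it equals
`r^{1-n} tr(U (r⁻¹ H_L + 1))` with `U` the cofactor matrix of `H_K` (`sum_weight_det`,
`mixedDet_smul`). Hence `∫ φ tr(U H_L) dS` is a combination of integrals `G` that make sense
and are continuous for all bodies `K`.

The function `u` enters through the identity
`∇u ⊗ ∇u = H[u²/2 + c] - u H[u + c] - (c - u²/2 - u c) Id` (`grad_mul_grad`). For a constant `c`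
that depends only on the `C²` norm of `u`, both `u²/2 + c` and `u + c` are support functions of
convex bodies `L₁`, `L₂`: if `∇²f + f Id ≥ 0`, then by Sturm comparison along great circles the
one-homogeneous extension of `f` lies above its tangent planes (`fderiv_hom1_le`). With `L₁`, `L₂`
and `L = 0` this yields a functional `Λ_K` (`cofactorFunctional`), continuous in `K`, which is
integration against `U^{ij} u_i u_j dS` when `h_K` is `C²` (`integral_cofactorMeasure`). Limits of
these functionals are positive, so they are measures by the Riesz–Markov–Kakutani theorem, and
`Λ_K(1)` is bounded by volumes of balls.

Finally, an origin-symmetric body is approximated by bodies with support functions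
`(∑ ⟪v, y⟫^{2m})^{1/(2m)} + δ|y|`, with `v` in a finite net of a parallel body and `m` large
(`exists_isSmoothPosEven_dist_le`).
-/

noncomputable section

namespace ConvexSphere

variable {n : ℕ}

/-! ### Nearest points and support functions of convex bodies -/

/-- `N` is the support function `y ↦ max_{z ∈ M} ⟪y, z⟫` of `M` on the whole space `ℝ^{n+1}`. -/
structure IsSupportFun (M : ConvexBody (E n)) (N : E n → ℝ) : Prop where
  le : ∀ (y : E n), ∀ z ∈ M, ⟪y, z⟫_ℝ ≤ N y
  exists_eq : ∀ y : E n, ∃ z ∈ M, ⟪y, z⟫_ℝ = N y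

theorem exists_nearest (M : ConvexBody (E n)) (x : E n) :
    ∃ p ∈ M, ∀ z ∈ M, ⟪x - p, z - p⟫_ℝ ≤ 0 := by
  obtain ⟨p, hp, h⟩ := exists_norm_eq_iInf_of_complete_convex M.nonempty
    M.isCompact.isComplete M.convex x
  exact ⟨p, hp, (norm_eq_iInf_iff_real_inner_le_zero M.convex hp).1 h⟩

/-- The point of `M` nearest to `x`. -/
def nearest (M : ConvexBody (E n)) (x : E n) : E n := (exists_nearest M x).choose

theorem nearest_mem (M : ConvexBody (E n)) (x : E n) : nearest M x ∈ M :=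
  (exists_nearest M x).choose_spec.1

theorem inner_sub_nearest_le (M : ConvexBody (E n)) (x : E n) {z : E n} (hz : z ∈ M) :
    ⟪x - nearest M x, z - nearest M x⟫_ℝ ≤ 0 :=
  (exists_nearest M x).choose_spec.2 z hz

theorem nearest_eq {M : ConvexBody (E n)} {x p : E n} (hp : p ∈ M)
    (h : ∀ z ∈ M, ⟪x - p, z - p⟫_ℝ ≤ 0) : nearest M x = p := by
  have h1 := h _ (nearest_mem M x)
  have h2 := inner_sub_nearest_le M x hp
  set q := nearest M x
  have : ⟪q - p, q - p⟫_ℝ ≤ 0 := by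
    have e : ⟪q - p, q - p⟫_ℝ = ⟪x - p, q - p⟫_ℝ + ⟪x - q, p - q⟫_ℝ := by
      have : q - p = (x - p) - (x - q) := by abel
      nth_rewrite 1 [this]
      rw [inner_sub_left, ← neg_sub q p, inner_neg_right]
      ring
    linarith
  exact sub_eq_zero.1 (inner_self_eq_zero.1 (le_antisymm this real_inner_self_nonneg))

theorem nearest_of_mem {M : ConvexBody (E n)} {x : E n} (hx : x ∈ M) : nearest M x = x :=
  nearest_eq hx fun z _ => by simp

theorem norm_sub_nearest_le (M : ConvexBody (E n)) (x : E n) {z : E n} (hz : z ∈ M) :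
    ‖x - nearest M x‖ ≤ ‖x - z‖ := by
  have h := inner_sub_nearest_le M x hz
  set p := nearest M x
  have e : ‖x - z‖ ^ 2 = ‖x - p‖ ^ 2 - 2 * ⟪x - p, z - p⟫_ℝ + ‖z - p‖ ^ 2 := by
    rw [← norm_sub_sq_real]; congr 2; abel
  refine le_of_sq_le_sq ?_ (norm_nonneg _)
  nlinarith [sq_nonneg ‖z - p‖]

theorem lipschitzWith_nearest (M : ConvexBody (E n)) : LipschitzWith 1 (nearest M) := by
  refine LipschitzWith.of_dist_le_mul fun x x' => ?_
  have h1 := inner_sub_nearest_le M x (nearest_mem M x')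
  have h2 := inner_sub_nearest_le M x' (nearest_mem M x)
  rw [dist_eq_norm, dist_eq_norm, NNReal.coe_one, one_mul]
  set p := nearest M x
  set p' := nearest M x'
  have e : ‖p - p'‖ ^ 2 = ⟪x - x', p - p'⟫_ℝ + ⟪x - p, p' - p⟫_ℝ + ⟪x' - p', p - p'⟫_ℝ := by
    rw [← real_inner_self_eq_norm_sq]
    simp only [inner_sub_left, inner_sub_right]
    ring
  have h3 := real_inner_le_norm (x - x') (p - p')
  by_contra! hc
  nlinarith [norm_nonneg (x - x'), norm_nonneg (p - p')]

theorem continuous_nearest (M : ConvexBody (E n)) : Continuous (nearest M) :=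
  (lipschitzWith_nearest M).continuous

theorem exists_norm_sub_le {M M' : ConvexBody (E n)} {δ : ℝ} (h : dist M M' < δ) {z : E n}
    (hz : z ∈ M) : ∃ z' ∈ M', ‖z - z'‖ ≤ δ := by
  obtain ⟨z', hz', h'⟩ := Metric.exists_dist_lt_of_hausdorffDist_lt (s := (M : Set (E n)))
    (t := (M' : Set (E n))) hz h ConvexBody.hausdorffEDist_ne_top
  exact ⟨z', hz', by rw [← dist_eq_norm]; exact h'.le⟩

/-- Stability of the nearest point under perturbation of the body in the Hausdorff metric. -/
theorem norm_nearest_sub_sq_le {M M' : ConvexBody (E n)} {δ : ℝ} (h : dist M M' < δ) (x : E n) :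
    ‖nearest M' x - nearest M x‖ ^ 2 ≤ δ * (2 * ‖x - nearest M x‖ + δ) := by
  have hδ : 0 ≤ δ := dist_nonneg.trans h.le
  obtain ⟨q', hq', hd'⟩ := exists_norm_sub_le h (nearest_mem M x)
  obtain ⟨q, hq, hd⟩ := exists_norm_sub_le (dist_comm M M' ▸ h) (nearest_mem M' x)
  have h1 := inner_sub_nearest_le M x hq
  have h2 := inner_sub_nearest_le M' x hq'
  have h3 := norm_sub_nearest_le M' x hq'
  set p := nearest M x
  set p' := nearest M' x
  have h4 : ‖x - p'‖ ≤ ‖x - p‖ + δ := by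
    have := norm_sub_le_norm_sub_add_norm_sub x p q'
    linarith
  have e : ‖p' - p‖ ^ 2 = ⟪x - p, q - p⟫_ℝ + ⟪x - p', q' - p'⟫_ℝ + ⟪x - p, p' - q⟫_ℝ
      + ⟪x - p', p - q'⟫_ℝ := by
    rw [← real_inner_self_eq_norm_sq]
    simp only [inner_sub_left, inner_sub_right]
    ring
  have h5 := real_inner_le_norm (x - p) (p' - q)
  have h6 := real_inner_le_norm (x - p') (p - q')
  have h7 : ‖x - p‖ * ‖p' - q‖ ≤ ‖x - p‖ * δ := by gcongr
  have h8 : ‖x - p'‖ * ‖p - q'‖ ≤ (‖x - p‖ + δ) * δ := by gcongr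
  linarith

theorem tendsto_nearest {ι : Type*} {l : Filter ι} {Mi : ι → ConvexBody (E n)}
    {M : ConvexBody (E n)} (h : Tendsto Mi l (𝓝 M)) (x : E n) :
    Tendsto (fun i => nearest (Mi i) x) l (𝓝 (nearest M x)) := by
  rw [tendsto_iff_norm_sub_tendsto_zero]
  have hlim : Tendsto (fun δ : ℝ => δ * (2 * ‖x - nearest M x‖ + δ)) (𝓝[>] 0) (𝓝 0) := by
    have : Continuous fun δ : ℝ => δ * (2 * ‖x - nearest M x‖ + δ) := by fun_prop
    simpa using (this.tendsto 0).mono_left nhdsWithin_le_nhds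
  refine Metric.tendsto_nhds.2 fun ε hε => ?_
  obtain ⟨δ, hδ, hδ0⟩ := ((hlim.eventually (gt_mem_nhds (pow_pos hε 2))).and
    self_mem_nhdsWithin).exists
  filter_upwards [Metric.tendsto_nhds.1 h δ hδ0] with i hi
  have := norm_nearest_sub_sq_le (dist_comm (Mi i) M ▸ hi) x
  rw [Real.dist_0_eq_abs, abs_of_nonneg (norm_nonneg _)]
  exact lt_of_pow_lt_pow_left₀ 2 hε.le (this.trans_lt hδ)

theorem mem_smul_add {s : ℝ} {K L : ConvexBody (E n)} {z : E n} :
    z ∈ s • K + L ↔ ∃ a ∈ K, ∃ b ∈ L, s • a + b = z := by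
  rw [← SetLike.mem_coe, ConvexBody.coe_add, ConvexBody.coe_smul, Set.mem_add]
  simp only [Set.mem_smul_set, SetLike.mem_coe]
  constructor
  · rintro ⟨_, ⟨a, ha, rfl⟩, b, hb, rfl⟩
    exact ⟨a, ha, b, hb, rfl⟩
  · rintro ⟨a, ha, b, hb, rfl⟩
    exact ⟨_, ⟨a, ha, rfl⟩, b, hb, rfl⟩

theorem dist_smul_add_le {s : ℝ} {K K' : ConvexBody (E n)} (L : ConvexBody (E n)) {δ : ℝ}
    (h : dist K K' < δ) : dist (s • K + L) (s • K' + L) ≤ |s| * δ := by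
  have key : ∀ {K K' : ConvexBody (E n)}, dist K K' < δ → ∀ z ∈ s • K + L,
      ∃ z' ∈ s • K' + L, dist z z' ≤ |s| * δ := by
    intro K K' h z hz
    obtain ⟨a, ha, b, hb, rfl⟩ := mem_smul_add.1 hz
    obtain ⟨a', ha', hd⟩ := exists_norm_sub_le h ha
    refine ⟨s • a' + b, mem_smul_add.2 ⟨a', ha', b, hb, rfl⟩, ?_⟩
    rw [dist_add_right, dist_eq_norm, ← smul_sub, norm_smul, Real.norm_eq_abs]
    gcongr
  have hδ : 0 ≤ δ := dist_nonneg.trans h.le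
  exact Metric.hausdorffDist_le_of_mem_dist (by positivity) (key h) (key (dist_comm K K' ▸ h))

theorem tendsto_smul_add {ι : Type*} {l : Filter ι} {Ki : ι → ConvexBody (E n)}
    {K : ConvexBody (E n)} (h : Tendsto Ki l (𝓝 K)) (s : ℝ) (L : ConvexBody (E n)) :
    Tendsto (fun i => s • Ki i + L) l (𝓝 (s • K + L)) := by
  refine Metric.tendsto_nhds.2 fun ε hε => ?_
  have hδ : 0 < ε / (|s| + 1) := by positivity
  filter_upwards [Metric.tendsto_nhds.1 h _ hδ] with i hi
  refine (dist_smul_add_le L hi).trans_lt ?_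
  rw [mul_div_assoc', div_lt_iff₀ (by positivity)]
  nlinarith [abs_nonneg s]

namespace IsSupportFun

variable {M K L : ConvexBody (E n)} {N N' : E n → ℝ}

theorem smul_add (hK : IsSupportFun K N) (hL : IsSupportFun L N') {s : ℝ} (hs : 0 ≤ s) :
    IsSupportFun (s • K + L) (fun y => s * N y + N' y) where
  le y z hz := by
    obtain ⟨a, ha, b, hb, rfl⟩ := mem_smul_add.1 hz
    rw [inner_add_right, inner_smul_right]
    have := mul_le_mul_of_nonneg_left (hK.le y a ha) hs
    linarith [hL.le y b hb]
  exists_eq y := by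
    obtain ⟨a, ha, h1⟩ := hK.exists_eq y
    obtain ⟨b, hb, h2⟩ := hL.exists_eq y
    exact ⟨_, mem_smul_add.2 ⟨a, ha, b, hb, rfl⟩, by
      rw [inner_add_right, inner_smul_right, h1, h2]⟩

theorem zero : IsSupportFun (0 : ConvexBody (E n)) (fun _ => 0) := by
  have h : ∀ z : E n, z ∈ (0 : ConvexBody (E n)) ↔ z = 0 := fun z => by
    rw [← SetLike.mem_coe, ConvexBody.coe_zero]; rfl
  exact ⟨fun y z hz => by simp [(h z).1 hz], fun y => ⟨0, (h 0).2 rfl, by simp⟩⟩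

theorem smul_pos (h : IsSupportFun M N) {r : ℝ} (hr : 0 < r) (y : E n) :
    N (r • y) = r * N y := by
  refine le_antisymm ?_ ?_
  · obtain ⟨z, hz, e⟩ := h.exists_eq (r • y)
    rw [← e, real_inner_smul_left]
    gcongr
    exact h.le y z hz
  · obtain ⟨z, hz, e⟩ := h.exists_eq y
    rw [← e, ← real_inner_smul_left]
    exact h.le _ z hz

/-- Where the support function is differentiable, its gradient at `y` is the only point of `M` that
maximizes `⟪y, ·⟫`. -/
theorem fderiv_eq (h : IsSupportFun M N) {y p : E n} (hd : DifferentiableAt ℝ N y) (hp : p ∈ M)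
    (he : ⟪y, p⟫_ℝ = N y) (w : E n) : fderiv ℝ N y w = ⟪w, p⟫_ℝ := by
  -- `N - ⟪·, p⟫` is nonnegative and vanishes at `y`
  have hmin : IsLocalMin (fun w => N w - ⟪w, p⟫_ℝ) y := by
    refine Filter.Eventually.of_forall fun w => ?_
    simp only [he, sub_self]
    exact sub_nonneg.2 (h.le w p hp)
  have hder : HasFDerivAt (fun w : E n => ⟪w, p⟫_ℝ) ((innerSL ℝ) p) y := by
    have := ((innerSL ℝ) p).hasFDerivAt (x := y)
    refine this.congr_of_eventuallyEq (Filter.Eventually.of_forall fun w => ?_)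
    simp [real_inner_comm]
  have h0 := hmin.hasFDerivAt_eq_zero (hd.hasFDerivAt.sub hder)
  have := congrArg (fun l => l w) h0
  simp only [_root_.sub_apply, innerSL_apply_apply, _root_.zero_apply] at this
  rw [real_inner_comm]
  linarith

theorem nearest_add (h : IsSupportFun M N) {y p : E n} (hp : p ∈ M) (he : ⟪y, p⟫_ℝ = N y) :
    nearest M (p + y) = p := by
  refine nearest_eq hp fun z hz => ?_
  rw [add_sub_cancel_left, inner_sub_right, he]
  linarith [h.le y z hz]

theorem inner_nearest (h : IsSupportFun M N) (x : E n) :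
    ⟪x - nearest M x, nearest M x⟫_ℝ = N (x - nearest M x) := by
  refine le_antisymm (h.le _ _ (nearest_mem M x)) ?_
  obtain ⟨z, hz, e⟩ := h.exists_eq (x - nearest M x)
  have := inner_sub_nearest_le M x hz
  rw [inner_sub_right] at this
  linarith

end IsSupportFun

/-! ### The Hessian of a support function and the change of variables -/

/-- The Riesz isomorphism from the dual of `ℝ^{n+1}` to `ℝ^{n+1}`, as a linear map over `ℝ`. -/
def riesz (n : ℕ) : (E n →L[ℝ] ℝ) →L[ℝ] E n :=
  LinearMap.toContinuousLinearMap
    { toFun := fun l => (InnerProductSpace.toDual ℝ (E n)).symm l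
      map_add' := fun l m => map_add _ l m
      map_smul' := fun c l => by simp }

theorem inner_riesz (l : E n →L[ℝ] ℝ) (w : E n) : ⟪riesz n l, w⟫_ℝ = l w :=
  InnerProductSpace.toDual_symm_apply

theorem riesz_eq {l : E n →L[ℝ] ℝ} {p : E n} (h : ∀ w, l w = ⟪w, p⟫_ℝ) : riesz n l = p :=
  ext_inner_right ℝ fun w => by rw [inner_riesz, h, real_inner_comm]

/-- The Euclidean Hessian of `N` at `y`, as an operator on `ℝ^{n+1}`. -/
def hessOp (N : E n → ℝ) (y : E n) : E n →L[ℝ] E n :=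
  (riesz n).comp (fderiv ℝ (fderiv ℝ N) y)

theorem inner_hessOp (N : E n → ℝ) (y X Y : E n) :
    ⟪hessOp N y X, Y⟫_ℝ = fderiv ℝ (fderiv ℝ N) y X Y :=
  inner_riesz _ _

section Smooth

variable {N N' : E n → ℝ}

theorem contDiffAt_of_ne (hN : ContDiffOn ℝ 2 N {0}ᶜ) {y : E n} (hy : y ≠ 0) :
    ContDiffAt ℝ 2 N y :=
  hN.contDiffAt (isOpen_compl_singleton.mem_nhds hy)

theorem differentiableAt_of_ne (hN : ContDiffOn ℝ 2 N {0}ᶜ) {y : E n} (hy : y ≠ 0) :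
    DifferentiableAt ℝ N y :=
  (contDiffAt_of_ne hN hy).differentiableAt (by norm_num)

theorem contDiffAt_fderiv_of_ne (hN : ContDiffOn ℝ 2 N {0}ᶜ) {y : E n} (hy : y ≠ 0) :
    ContDiffAt ℝ 1 (fderiv ℝ N) y :=
  (contDiffAt_of_ne hN hy).fderiv_right (by norm_num)

theorem hasFDerivAt_fderiv_of_ne (hN : ContDiffOn ℝ 2 N {0}ᶜ) {y : E n} (hy : y ≠ 0) :
    HasFDerivAt (fderiv ℝ N) (fderiv ℝ (fderiv ℝ N) y) y :=
  ((contDiffAt_fderiv_of_ne hN hy).differentiableAt (by norm_num)).hasFDerivAt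

theorem hasFDerivAt_riesz_fderiv (hN : ContDiffOn ℝ 2 N {0}ᶜ) {y : E n} (hy : y ≠ 0) :
    HasFDerivAt (fun y => riesz n (fderiv ℝ N y)) (hessOp N y) y :=
  (riesz n).hasFDerivAt.comp y (hasFDerivAt_fderiv_of_ne hN hy)

theorem continuousOn_hessOp (hN : ContDiffOn ℝ 2 N {0}ᶜ) : ContinuousOn (hessOp N) {0}ᶜ := by
  intro y hy
  have h : ContinuousAt (fderiv ℝ (fderiv ℝ N)) y :=
    ((contDiffAt_fderiv_of_ne hN hy).fderiv_right (m := 0) (by norm_num)).continuousAt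
  exact (continuousAt_const.clm_comp h).continuousWithinAt

theorem hessOp_comm (hN : ContDiffOn ℝ 2 N {0}ᶜ) {y : E n} (hy : y ≠ 0) (X Y : E n) :
    ⟪hessOp N y X, Y⟫_ℝ = ⟪hessOp N y Y, X⟫_ℝ := by
  rw [inner_hessOp, inner_hessOp]
  exact ((contDiffAt_of_ne hN hy).isSymmSndFDerivAt (by simp)) X Y

theorem hessOp_smul_add (hN : ContDiffOn ℝ 2 N {0}ᶜ) (hN' : ContDiffOn ℝ 2 N' {0}ᶜ) (s : ℝ)
    {y : E n} (hy : y ≠ 0) :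
    hessOp (fun y => s * N y + N' y) y = s • hessOp N y + hessOp N' y := by
  have h : fderiv ℝ (fun y => s * N y + N' y) =ᶠ[𝓝 y]
      fun y => s • fderiv ℝ N y + fderiv ℝ N' y := by
    filter_upwards [isOpen_compl_singleton.mem_nhds hy] with z hz
    exact (((differentiableAt_of_ne hN hz).hasFDerivAt.const_mul s).add
      (differentiableAt_of_ne hN' hz).hasFDerivAt).fderiv
  have h2 : fderiv ℝ (fun y => s • fderiv ℝ N y + fderiv ℝ N' y) y =
      s • fderiv ℝ (fderiv ℝ N) y + fderiv ℝ (fderiv ℝ N') y :=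
    (((hasFDerivAt_fderiv_of_ne hN hy).const_smul s).add (hasFDerivAt_fderiv_of_ne hN' hy)).fderiv
  rw [hessOp, h.fderiv_eq, h2, ContinuousLinearMap.comp_add, ContinuousLinearMap.comp_smul]
  rfl

/-- The gradient of a function homogeneous of degree one is homogeneous of degree zero. -/
theorem fderiv_smul_pos (h1 : ∀ r > 0, ∀ y, N (r • y) = r * N y) {r : ℝ} (hr : 0 < r) (y : E n) :
    fderiv ℝ N (r • y) = fderiv ℝ N y := by
  have e : (fun y => N (r • y)) = fun y => r • N y := funext fun y => h1 r hr y
  have h2 : fderiv ℝ (fun y => N (r • y)) y = r • fderiv ℝ N (r • y) := fderiv_comp_smul r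
  have h3 : fderiv ℝ (fun y => r • N y) y = r • fderiv ℝ N y :=
    congrFun (fderiv_const_smul_field (f := N) r) y
  rw [e, h3] at h2
  exact (smul_right_injective _ hr.ne' h2).symm

theorem hessOp_smul_pos (h1 : ∀ r > 0, ∀ y, N (r • y) = r * N y) {r : ℝ} (hr : 0 < r) (y : E n) :
    hessOp N (r • y) = r⁻¹ • hessOp N y := by
  have e : (fun y => fderiv ℝ N (r • y)) = fderiv ℝ N := funext fun y => fderiv_smul_pos h1 hr y
  have h2 : fderiv ℝ (fun y => fderiv ℝ N (r • y)) y = r • fderiv ℝ (fderiv ℝ N) (r • y) :=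
    fderiv_comp_smul r
  rw [e] at h2
  rw [hessOp, hessOp, h2, ContinuousLinearMap.comp_smul, smul_smul, inv_mul_cancel₀ hr.ne',
    one_smul]

theorem hessOp_apply_self (hN : ContDiffOn ℝ 2 N {0}ᶜ) (h1 : ∀ r > 0, ∀ y, N (r • y) = r * N y)
    {y : E n} (hy : y ≠ 0) : hessOp N y y = 0 := by
  have hf := hasFDerivAt_fderiv_of_ne hN hy
  have hc : HasDerivAt (fun t : ℝ => t • y) y 1 := by
    simpa using (hasDerivAt_id (1 : ℝ)).smul_const y
  have h2 : HasDerivAt (fun t : ℝ => fderiv ℝ N (t • y)) (fderiv ℝ (fderiv ℝ N) y y) 1 := by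
    have hf' : HasFDerivAt (fderiv ℝ N) (fderiv ℝ (fderiv ℝ N) y) ((1 : ℝ) • y) := by
      rwa [one_smul]
    exact hf'.comp_hasDerivAt (1 : ℝ) hc
  have h3 : HasDerivAt (fun t : ℝ => fderiv ℝ N (t • y)) 0 1 := by
    refine (hasDerivAt_const (1 : ℝ) (fderiv ℝ N y)).congr_of_eventuallyEq ?_
    filter_upwards [lt_mem_nhds (zero_lt_one (α := ℝ))] with t ht
    exact fderiv_smul_pos h1 ht y
  rw [hessOp, ContinuousLinearMap.comp_apply, h2.unique h3, map_zero]

/-- Euler's relation for a function homogeneous of degree one. -/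
theorem fderiv_apply_self (hN : ContDiffOn ℝ 2 N {0}ᶜ) (h1 : ∀ r > 0, ∀ y, N (r • y) = r * N y)
    {y : E n} (hy : y ≠ 0) : fderiv ℝ N y y = N y := by
  have hf := (differentiableAt_of_ne hN hy).hasFDerivAt
  have hc : HasDerivAt (fun t : ℝ => t • y) y 1 := by
    simpa using (hasDerivAt_id (1 : ℝ)).smul_const y
  have h2 : HasDerivAt (fun t : ℝ => N (t • y)) (fderiv ℝ N y y) 1 := by
    have hf' : HasFDerivAt N (fderiv ℝ N y) ((1 : ℝ) • y) := by rwa [one_smul]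
    exact hf'.comp_hasDerivAt (1 : ℝ) hc
  have h3 : HasDerivAt (fun t : ℝ => N (t • y)) (N y) 1 := by
    have : HasDerivAt (fun t : ℝ => t * N y) (N y) 1 := by
      simpa using (hasDerivAt_id (1 : ℝ)).mul_const (N y)
    refine this.congr_of_eventuallyEq ?_
    filter_upwards [lt_mem_nhds (zero_lt_one (α := ℝ))] with t ht
    exact h1 t ht y
  exact h2.unique h3

end Smooth

namespace IsSupportFun

variable {M : ConvexBody (E n)} {N : E n → ℝ}

theorem riesz_fderiv_mem (h : IsSupportFun M N) {y : E n} (hd : DifferentiableAt ℝ N y) :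
    riesz n (fderiv ℝ N y) ∈ M ∧ ⟪y, riesz n (fderiv ℝ N y)⟫_ℝ = N y := by
  obtain ⟨p, hp, he⟩ := h.exists_eq y
  rw [riesz_eq (h.fderiv_eq hd hp he)]
  exact ⟨hp, he⟩

/-- The support function is convex. -/
theorem hessOp_nonneg (h : IsSupportFun M N) (hN : ContDiffOn ℝ 2 N {0}ᶜ) {y : E n} (hy : y ≠ 0)
    (X : E n) : 0 ≤ ⟪hessOp N y X, X⟫_ℝ := by
  have hc : HasDerivAt (fun t : ℝ => y + t • X) X 0 := by
    simpa using ((hasDerivAt_id (0 : ℝ)).smul_const X).const_add y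
  have hc0 : y + (0 : ℝ) • X = y := by simp
  have h2 : HasDerivAt (fun t : ℝ => ⟪riesz n (fderiv ℝ N (y + t • X)), X⟫_ℝ)
      ⟪hessOp N y X, X⟫_ℝ 0 := by
    have := hasFDerivAt_riesz_fderiv hN hy
    rw [← hc0] at this
    have h3 := this.comp_hasDerivAt (0 : ℝ) hc
    rw [hc0] at h3
    have := h3.inner ℝ (hasDerivAt_const (0 : ℝ) X)
    simpa using this
  have hmem : ∀ᶠ t : ℝ in 𝓝 0, y + t • X ≠ 0 := by
    have : ContinuousAt (fun t : ℝ => y + t • X) 0 := hc.continuousAt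
    exact this.eventually_ne (by simpa using hy)
  -- difference quotients are nonnegative, as the gradient is monotone
  refine ge_of_tendsto h2.tendsto_slope ?_
  filter_upwards [hmem.filter_mono nhdsWithin_le_nhds, self_mem_nhdsWithin] with t ht ht0
  have ha := h.riesz_fderiv_mem (differentiableAt_of_ne hN hy)
  have hb := h.riesz_fderiv_mem (differentiableAt_of_ne hN ht)
  have h3 := h.le y _ hb.1
  have h4 := h.le (y + t • X) _ ha.1
  rw [← ha.2] at h3
  rw [← hb.2] at h4
  have ht0 : t ≠ 0 := ht0
  rw [slope_def_field, hc0, sub_zero]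
  set a := riesz n (fderiv ℝ N y)
  set b := riesz n (fderiv ℝ N (y + t • X))
  have h5 : 0 ≤ t * (⟪b, X⟫_ℝ - ⟪a, X⟫_ℝ) := by
    simp only [inner_add_left, real_inner_smul_left] at h4
    rw [real_inner_comm X b, real_inner_comm X a]
    linarith
  have : (⟪b, X⟫_ℝ - ⟪a, X⟫_ℝ) / t = t * (⟪b, X⟫_ℝ - ⟪a, X⟫_ℝ) / t ^ 2 := by
    field_simp
  rw [this]
  positivity

/-- The change of variables `x = ∇N(y) + y`, inverse to `x ↦ x - nearest M x` outside of `M`. -/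
theorem integral_comp_sub_nearest (h : IsSupportFun M N) (hN : ContDiffOn ℝ 2 N {0}ᶜ)
    {ψ : E n → ℝ} (hψ : ψ 0 = 0) :
    ∫ x, ψ (x - nearest M x) = ∫ y in {0}ᶜ, |(hessOp N y + 1).det| * ψ y := by
  set F : E n → E n := fun y => riesz n (fderiv ℝ N y) + y with hF
  have hnear : ∀ y : E n, y ≠ 0 → F y - nearest M (F y) = y := by
    intro y hy
    obtain ⟨h1, h2⟩ := h.riesz_fderiv_mem (differentiableAt_of_ne hN hy)
    rw [hF]
    simp only
    rw [h.nearest_add h1 h2, add_sub_cancel_left]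
  have hinj : Set.InjOn F {0}ᶜ := fun y hy y' hy' e => by
    rw [← hnear y hy, ← hnear y' hy', e]
  have himg : F '' {0}ᶜ = (M : Set (E n))ᶜ := by
    ext x
    constructor
    · rintro ⟨y, hy, rfl⟩ hx
      have := hnear y hy
      rw [nearest_of_mem hx, sub_self] at this
      exact hy this.symm
    · intro hx
      have hy : x - nearest M x ≠ 0 := fun h0 => hx (by
        rw [sub_eq_zero.1 h0]; exact nearest_mem M x)
      refine ⟨x - nearest M x, hy, ?_⟩
      simp only [hF]
      rw [riesz_eq (h.fderiv_eq (differentiableAt_of_ne hN hy) (nearest_mem M x)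
        (h.inner_nearest x))]
      abel
  have key := integral_image_eq_integral_abs_det_fderiv_smul (μ := volume)
    (s := ({0}ᶜ : Set (E n))) (f := F) (f' := fun y => hessOp N y + 1)
    (measurableSet_singleton 0).compl
    (fun y hy => ((hasFDerivAt_riesz_fderiv hN hy).add (hasFDerivAt_id y)).hasFDerivWithinAt)
    hinj (fun x => ψ (x - nearest M x))
  rw [himg] at key
  rw [← setIntegral_eq_integral_of_forall_compl_eq_zero (s := (M : Set (E n))ᶜ), key]
  · refine setIntegral_congr_fun (measurableSet_singleton 0).compl fun y hy => ?_
    simp only [smul_eq_mul]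
    rw [hnear y hy]
  · intro x hx
    rw [nearest_of_mem (not_not.1 hx), sub_self, hψ]

end IsSupportFun

/-! ### Functions on the sphere and their homogeneous extensions -/

/-- The extension of `f` from `S^n` to `ℝ^{n+1}` which is homogeneous of degree one. -/
def hom1 (f : S n → ℝ) (y : E n) : ℝ := ‖y‖ * ext0 f y

theorem ne_zero_coe (x : S n) : (x : E n) ≠ 0 := ne_zero_of_mem_unit_sphere x

@[simp]
theorem norm_coe (x : S n) : ‖(x : E n)‖ = 1 := norm_eq_of_mem_sphere x

theorem ext0_eq {f : S n → ℝ} {y : E n} {x : S n} {r : ℝ} (hr : 0 < r) (h : y = r • (x : E n)) :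
    ext0 f y = f x := by
  have hy : y ≠ 0 := h ▸ smul_ne_zero hr.ne' (ne_zero_coe x)
  rw [ext0, dif_neg hy]
  congr 1
  ext1
  simp only [h, norm_smul, norm_coe, Real.norm_eq_abs, abs_of_pos hr, mul_one, smul_smul,
    inv_mul_cancel₀ hr.ne', one_smul]

@[simp]
theorem ext0_coe (f : S n → ℝ) (x : S n) : ext0 f (x : E n) = f x :=
  ext0_eq one_pos (one_smul ℝ _).symm

@[simp]
theorem hom1_coe (f : S n → ℝ) (x : S n) : hom1 f (x : E n) = f x := by simp [hom1]

theorem exists_eq_smul {y : E n} (hy : y ≠ 0) : ∃ x : S n, y = ‖y‖ • (x : E n) := by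
  have h : ‖y‖ ≠ 0 := norm_ne_zero_iff.2 hy
  exact ⟨⟨‖y‖⁻¹ • y, by simp [norm_smul, h]⟩, by simp [smul_smul, h]⟩

theorem hom1_smul_pos (f : S n → ℝ) (r : ℝ) (hr : r > 0) (y : E n) :
    hom1 f (r • y) = r * hom1 f y := by
  by_cases hy : y = 0
  · simp [hom1, hy]
  obtain ⟨x, hx⟩ := exists_eq_smul hy
  have hn : 0 < ‖y‖ := norm_pos_iff.2 hy
  have h2 : r • y = (r * ‖y‖) • (x : E n) := by rw [mul_smul, ← hx]
  rw [hom1, hom1, ext0_eq (mul_pos hr hn) h2, ext0_eq hn hx, norm_smul, Real.norm_eq_abs,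
    abs_of_pos hr, mul_assoc]

theorem contDiffOn_norm_inv : ContDiffOn ℝ 2 (fun y : E n => ‖y‖⁻¹) {0}ᶜ := fun _ hy =>
  ((contDiffAt_norm ℝ hy).inv (norm_ne_zero_iff.2 hy)).contDiffWithinAt

theorem contDiffOn_ext0 {f : S n → ℝ} (hf : IsC2 f) : ContDiffOn ℝ 2 (ext0 f) {0}ᶜ := by
  have : Fact (Module.finrank ℝ (E n) = n + 1) := ⟨finrank_euclideanSpace_fin⟩
  let U : TopologicalSpace.Opens (E n) := ⟨{0}ᶜ, isOpen_compl_singleton⟩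
  have hU : ∀ y : U, (y : E n) ≠ 0 := fun y => y.2
  have hg : ContMDiff 𝓘(ℝ, E n) 𝓘(ℝ, E n) 2 (fun y : U => ‖(y : E n)‖⁻¹ • (y : E n)) := by
    intro y
    refine (contMDiffAt_subtype_iff (f := fun y : E n => ‖y‖⁻¹ • y)).2 ?_
    exact ((contDiffAt_of_ne contDiffOn_norm_inv (hU y)).smul contDiffAt_id).contMDiffAt
  have hg' : ∀ y : U, ‖(y : E n)‖⁻¹ • (y : E n) ∈ sphere (0 : E n) 1 := fun y => by
    have : ‖(y : E n)‖ ≠ 0 := norm_ne_zero_iff.2 (hU y)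
    simp [norm_smul, this]
  have h := hf.comp (hg.codRestrict_sphere hg')
  intro y hy
  refine ContDiffAt.contDiffWithinAt (contMDiffAt_iff_contDiffAt.1 ?_)
  refine (contMDiffAt_subtype_iff (U := U) (x := ⟨y, hy⟩)).1 ?_
  refine (h ⟨y, hy⟩).congr_of_eventuallyEq (Filter.Eventually.of_forall fun z => ?_)
  simp only [ext0, dif_neg (hU z), Function.comp_apply]
  rfl

theorem contDiffOn_hom1 {f : S n → ℝ} (hf : IsC2 f) : ContDiffOn ℝ 2 (hom1 f) {0}ᶜ := fun _ hy =>
  ((contDiffAt_norm ℝ hy).mul (contDiffAt_of_ne (contDiffOn_ext0 hf) hy)).contDiffWithinAt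

theorem isC2_of_contDiffOn {f : S n → ℝ} {g : E n → ℝ} (hg : ContDiffOn ℝ 2 g {0}ᶜ)
    (h : ∀ x : S n, f x = g x) : IsC2 f := by
  have : Fact (Module.finrank ℝ (E n) = n + 1) := ⟨finrank_euclideanSpace_fin⟩
  intro x
  have h1 : ContMDiffAt 𝓘(ℝ, E n) 𝓘(ℝ, ℝ) 2 g (x : E n) :=
    (contDiffAt_of_ne hg (ne_zero_coe x)).contMDiffAt
  have h2 := h1.comp x ((contMDiff_coe_sphere (m := 2) (n := n) (E := E n)) x)
  exact h2.congr_of_eventuallyEq (Filter.Eventually.of_forall h)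

theorem IsC2.continuous {f : S n → ℝ} (hf : IsC2 f) : Continuous f := ContMDiff.continuous hf

theorem IsC2.add_const {f : S n → ℝ} (hf : IsC2 f) (c : ℝ) : IsC2 fun x => f x + c :=
  isC2_of_contDiffOn ((contDiffOn_ext0 hf).add (contDiffOn_const (c := c))) fun x => by simp

theorem IsC2.half_sq {f : S n → ℝ} (hf : IsC2 f) : IsC2 fun x => f x ^ 2 / 2 :=
  isC2_of_contDiffOn (((contDiffOn_ext0 hf).pow 2).div_const 2) fun x => by simp

theorem bddAbove_supp (M : ConvexBody (E n)) (y : E n) :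
    BddAbove ((fun z : E n => ⟪y, z⟫_ℝ) '' (M : Set (E n))) :=
  (M.isCompact.image (by fun_prop)).bddAbove

theorem isSupportFun_supp (M : ConvexBody (E n)) : IsSupportFun M (hom1 (supp M)) := by
  have key : ∀ y : E n, y ≠ 0 →
      hom1 (supp M) y = sSup ((fun z : E n => ⟪y, z⟫_ℝ) '' (M : Set (E n))) := by
    intro y hy
    obtain ⟨x, hx⟩ := exists_eq_smul hy
    rw [hom1, ext0_eq (norm_pos_iff.2 hy) hx, supp, ← smul_eq_mul,
      ← Real.sSup_smul_of_nonneg (norm_nonneg _)]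
    congr 1
    rw [← Set.image_smul, Set.image_image]
    refine Set.image_congr fun z _ => ?_
    rw [smul_eq_mul, ← real_inner_smul_left, ← hx]
  constructor
  · intro y z hz
    by_cases hy : y = 0
    · simp [hy, hom1]
    rw [key y hy]
    exact le_csSup (bddAbove_supp M y) ⟨z, hz, rfl⟩
  · intro y
    by_cases hy : y = 0
    · obtain ⟨z, hz⟩ := M.nonempty
      exact ⟨z, hz, by simp [hy, hom1]⟩
    rw [key y hy]
    exact (M.isCompact.image (f := fun z : E n => ⟪y, z⟫_ℝ) (by fun_prop)).sSup_mem
      (M.nonempty.image _)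

theorem IsSupportFun.supp_eq {M : ConvexBody (E n)} {N : E n → ℝ} (h : IsSupportFun M N)
    (x : S n) : supp M x = N x := by
  obtain ⟨z, hz, e⟩ := h.exists_eq x
  refine le_antisymm (csSup_le (M.nonempty.image _) ?_) ?_
  · rintro _ ⟨w, hw, rfl⟩
    exact h.le x w hw
  · rw [← e]
    exact le_csSup (bddAbove_supp M x) ⟨z, hz, rfl⟩

theorem inner_tangent (x : S n) (X : T x) : ⟪(x : E n), (X : E n)⟫_ℝ = 0 :=
  Submodule.mem_orthogonal_singleton_iff_inner_right.1 X.2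

theorem hasFDerivAt_norm_of_ne {y : E n} (hy : y ≠ 0) :
    HasFDerivAt (fun y : E n => ‖y‖) (‖y‖⁻¹ • innerSL ℝ y) y := by
  have h := (hasStrictFDerivAt_norm_sq y).hasFDerivAt.sqrt
    (by simpa using hy : ‖y‖ ^ 2 ≠ 0)
  refine (h.congr_of_eventuallyEq (Filter.Eventually.of_forall fun z => ?_)).congr_fderiv ?_
  · simp [Real.sqrt_sq]
  · rw [Real.sqrt_sq (norm_nonneg _)]
    ext w
    simp
    ring

/-- On tangent vectors, the Hessian of the one-homogeneous extension of `f` is `∇²f + f Id`. -/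
theorem fderiv_fderiv_hom1 {f : S n → ℝ} (hf : IsC2 f) (x : S n) (X Y : T x) :
    fderiv ℝ (fderiv ℝ (hom1 f)) (x : E n) X Y = formH f x X Y := by
  have h0 := contDiffOn_ext0 hf
  have h1 := contDiffOn_hom1 hf
  have hx := ne_zero_coe x
  have e1 : fderiv ℝ (fderiv ℝ (hom1 f)) (x : E n) X Y =
      fderiv ℝ (fun y => fderiv ℝ (hom1 f) y Y) (x : E n) X := by
    rw [((hasFDerivAt_fderiv_of_ne h1 hx).clm_apply (hasFDerivAt_const (Y : E n) _)).fderiv]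
    simp
  have e2 : (fun y => fderiv ℝ (hom1 f) y Y) =ᶠ[𝓝 (x : E n)]
      fun y => ‖y‖ * fderiv ℝ (ext0 f) y Y + ext0 f y * (‖y‖⁻¹ * ⟪y, Y⟫_ℝ) := by
    filter_upwards [isOpen_compl_singleton.mem_nhds hx] with y hy
    have := (hasFDerivAt_norm_of_ne hy).mul (differentiableAt_of_ne h0 hy).hasFDerivAt
    have h3 : fderiv ℝ (hom1 f) y = _ := this.fderiv
    rw [h3]
    simp
  have d1 : HasFDerivAt (fun y => fderiv ℝ (ext0 f) y Y) _ (x : E n) :=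
    (hasFDerivAt_fderiv_of_ne h0 hx).clm_apply (hasFDerivAt_const (Y : E n) _)
  have d2 : HasFDerivAt (fun y : E n => ‖y‖⁻¹) _ (x : E n) :=
    (differentiableAt_of_ne contDiffOn_norm_inv hx).hasFDerivAt
  have d3 : HasFDerivAt (fun y : E n => ⟪y, Y⟫_ℝ) _ (x : E n) :=
    (hasFDerivAt_id (x : E n)).inner ℝ (hasFDerivAt_const (Y : E n) _)
  have d4 := ((hasFDerivAt_norm_of_ne hx).mul d1).add
    ((differentiableAt_of_ne h0 hx).hasFDerivAt.mul (d2.mul d3))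
  have d5 : fderiv ℝ (fun y => fderiv ℝ (hom1 f) y Y) (x : E n) = _ :=
    (d4.congr_of_eventuallyEq e2).fderiv
  rw [e1, d5]
  simp [inner_tangent, formH, hess]

theorem ext0_comp (F : ℝ → ℝ) (f : S n → ℝ) {y : E n} (hy : y ≠ 0) :
    ext0 (fun x => F (f x)) y = F (ext0 f y) := by
  obtain ⟨x, hx⟩ := exists_eq_smul hy
  rw [ext0_eq (norm_pos_iff.2 hy) hx, ext0_eq (norm_pos_iff.2 hy) hx]

theorem hess_add_const (f : S n → ℝ) (c : ℝ) (x : S n) :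
    hess (fun x => f x + c) x = hess f x := by
  have e : ext0 (fun x => f x + c) =ᶠ[𝓝 (x : E n)] fun y => ext0 f y + c := by
    filter_upwards [isOpen_compl_singleton.mem_nhds (ne_zero_coe x)] with y hy
    exact ext0_comp (fun t => t + c) f hy
  rw [hess, hess, e.fderiv.fderiv_eq]
  congr 2
  exact funext fun y => fderiv_add_const c

theorem formH_add_const (f : S n → ℝ) (c : ℝ) (x : S n) (X Y : T x) :
    formH (fun x => f x + c) x X Y = formH f x X Y + c * ⟪X, Y⟫_ℝ := by
  rw [formH, formH, hess_add_const]
  ring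

theorem hess_half_sq {u : S n → ℝ} (hu : IsC2 u) (x : S n) (X Y : T x) :
    hess (fun x => u x ^ 2 / 2) x X Y = u x * hess u x X Y + grad u x X * grad u x Y := by
  have h0 := contDiffOn_ext0 hu
  have hx := ne_zero_coe x
  have e : fderiv ℝ (ext0 (fun x => u x ^ 2 / 2)) =ᶠ[𝓝 (x : E n)]
      fun y => ext0 u y • fderiv ℝ (ext0 u) y := by
    filter_upwards [isOpen_compl_singleton.mem_nhds hx] with y hy
    have e : ext0 (fun x => u x ^ 2 / 2) =ᶠ[𝓝 y] fun y => ext0 u y * ext0 u y * (1 / 2) := by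
      filter_upwards [isOpen_compl_singleton.mem_nhds hy] with z hz
      rw [ext0_comp (fun t => t ^ 2 / 2) u hz]
      ring
    have hd := (differentiableAt_of_ne h0 hy).hasFDerivAt
    have h3 : fderiv ℝ (fun y => ext0 u y * ext0 u y * (1 / 2)) y = _ :=
      ((hd.mul hd).mul_const (1 / 2)).fderiv
    rw [e.fderiv_eq, h3]
    ext w
    simp
    ring
  have h2 := ((differentiableAt_of_ne h0 hx).hasFDerivAt.smul
    (hasFDerivAt_fderiv_of_ne h0 hx)).fderiv
  simp only [hess, grad]
  rw [e.fderiv_eq]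
  rw [show fderiv ℝ (fun y => ext0 u y • fderiv ℝ (ext0 u) y) (x : E n) = _ from h2]
  simp

/-- The polarization of `∇u ⊗ ∇u` by the forms `H` of `u ^ 2 / 2 + c` and `u + c`. -/
theorem grad_mul_grad {u : S n → ℝ} (hu : IsC2 u) (c : ℝ) (x : S n) (X Y : T x) :
    grad u x X * grad u x Y = formH (fun x => u x ^ 2 / 2 + c) x X Y
      - u x * formH (fun x => u x + c) x X Y - (c - u x ^ 2 / 2 - u x * c) * ⟪X, Y⟫_ℝ := by
  rw [formH_add_const, formH_add_const, formH, formH, hess_half_sq hu]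
  ring

/-! ### Mixed determinants by interpolation -/

/-- Lagrange interpolation expresses a coefficient of a polynomial of degree at most `N` by its
values at `0, …, N`. -/
theorem exists_coeff_weights (N k : ℕ) : ∃ a : ℕ → ℝ, ∀ p : Polynomial ℝ, p.natDegree ≤ N →
    p.coeff k = ∑ j ∈ Finset.range (N + 1), a j * p.eval (j : ℝ) := by
  refine ⟨fun j => (Lagrange.basis (Finset.range (N + 1)) (fun j : ℕ => (j : ℝ)) j).coeff k,
    fun p hp => ?_⟩
  have hinj : Set.InjOn (fun j : ℕ => (j : ℝ)) (Finset.range (N + 1)) :=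
    Nat.cast_injective.injOn
  have h := Lagrange.eq_interpolate (f := p) hinj (by
    rw [Finset.card_range]
    exact (Polynomial.degree_le_natDegree).trans_lt (by exact_mod_cast Nat.lt_succ_of_le hp))
  nth_rewrite 1 [h]
  rw [Lagrange.interpolate_apply, Polynomial.finsetSum_coeff]
  refine Finset.sum_congr rfl fun j _ => ?_
  rw [Polynomial.coeff_C_mul, mul_comm]

/-- Weights for which `∑ j, weight n j * p(j)` is the coefficient of degree `n - 1` of `p`, if
`p` has degree at most `n`. -/
def weight (n : ℕ) : ℕ → ℝ := (exists_coeff_weights n (n - 1)).choose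

theorem coeff_eq_sum_weight {p : Polynomial ℝ} (hp : p.natDegree ≤ n) :
    p.coeff (n - 1) = ∑ j ∈ Finset.range (n + 1), weight n j * p.eval (j : ℝ) :=
  (exists_coeff_weights n (n - 1)).choose_spec p hp

open Polynomial in
theorem sum_weight_det_eq_coeff (A B : Matrix (Fin n) (Fin n) ℝ) :
    ∑ j ∈ Finset.range (n + 1), weight n j * ((j : ℝ) • A + B).det =
      (((X : ℝ[X]) • A.map C + B.map C).det).coeff (n - 1) := by
  have hdeg := natDegree_det_X_add_C_le A B
  rw [Fintype.card_fin] at hdeg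
  rw [coeff_eq_sum_weight hdeg]
  refine Finset.sum_congr rfl fun j _ => ?_
  congr 1
  rw [← coe_evalRingHom, RingHom.map_det]
  congr 1
  ext i k
  simp only [Matrix.add_apply, Matrix.smul_apply, Matrix.map_apply, RingHom.mapMatrix_apply,
    smul_eq_mul, coe_evalRingHom, eval_add, eval_mul, eval_X, eval_C]

open Polynomial in
/-- For invertible `A`, the coefficient is read off from the characteristic polynomial of
`-A⁻¹ B`. -/
theorem sum_weight_det_of_isUnit (hn : 1 ≤ n) {A : Matrix (Fin n) (Fin n) ℝ} (hA : IsUnit A.det)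
    (B : Matrix (Fin n) (Fin n) ℝ) :
    ∑ j ∈ Finset.range (n + 1), weight n j * ((j : ℝ) • A + B).det =
      (A.adjugate * B).trace := by
  have : Nonempty (Fin n) := ⟨⟨0, hn⟩⟩
  rw [sum_weight_det_eq_coeff]
  have h1 : (X : ℝ[X]) • A.map C + B.map C = A.map C * (-(A⁻¹ * B)).charmatrix := by
    have h2 : A.map (C : ℝ → ℝ[X]) * (A⁻¹ * B).map C = B.map C := by
      rw [← Matrix.map_mul, Matrix.mul_nonsing_inv_cancel_left _ _ hA]
    rw [Matrix.charmatrix, Matrix.mul_sub, map_neg, mul_neg, sub_neg_eq_add]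
    simp only [RingHom.mapMatrix_apply]
    rw [h2]
    congr 1
    rw [Matrix.scalar_apply, ← Matrix.smul_eq_mul_diagonal]
  rw [h1, Matrix.det_mul]
  have h3 : (A.map (C : ℝ → ℝ[X])).det = C A.det := by
    rw [RingHom.map_det]; rfl
  have h4 := Matrix.trace_eq_neg_charpoly_coeff (-(A⁻¹ * B))
  rw [Fintype.card_fin, Matrix.charpoly, Matrix.trace_neg] at h4
  rw [h3, coeff_C_mul, ← neg_eq_iff_eq_neg.2 h4.symm.symm]
  have h5 : A.adjugate = A.det • A⁻¹ := by
    rw [Matrix.inv_def, smul_smul, Ring.mul_inverse_cancel _ hA, one_smul]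
  rw [h5, Matrix.smul_mul, Matrix.trace_smul, smul_eq_mul, neg_neg]

/-- The coefficient of `s ^ (n - 1)` in `det (s A + B)` is the mixed discriminant `tr (adj A B)`. -/
theorem sum_weight_det (hn : 1 ≤ n) (A B : Matrix (Fin n) (Fin n) ℝ) :
    ∑ j ∈ Finset.range (n + 1), weight n j * ((j : ℝ) • A + B).det =
      (A.adjugate * B).trace := by
  -- both sides are continuous in `A`, and `A + t` is invertible for small `t ≠ 0`
  have hc : Continuous fun t : ℝ => A + t • (1 : Matrix (Fin n) (Fin n) ℝ) := by fun_prop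
  have hl : Continuous fun t : ℝ => ∑ j ∈ Finset.range (n + 1),
      weight n j * ((j : ℝ) • (A + t • (1 : Matrix (Fin n) (Fin n) ℝ)) + B).det := by
    refine continuous_finsetSum _ fun j _ => continuous_const.mul ?_
    exact Continuous.matrix_det (by fun_prop)
  have hr : Continuous fun t : ℝ =>
      ((A + t • (1 : Matrix (Fin n) (Fin n) ℝ)).adjugate * B).trace :=
    ((hc.matrix_adjugate).matrix_mul continuous_const).matrix_trace
  have hev : ∀ᶠ t : ℝ in 𝓝[≠] 0, IsUnit (A + t • (1 : Matrix (Fin n) (Fin n) ℝ)).det := by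
    have hfin : {t : ℝ | (-A).charpoly.IsRoot t}.Finite :=
      Polynomial.finite_setOfPred_isRoot (Matrix.charpoly_monic _).ne_zero
    have h0 : ∀ᶠ t : ℝ in 𝓝[≠] 0, t ∈ ({t : ℝ | (-A).charpoly.IsRoot t} \ {0})ᶜ :=
      mem_nhdsWithin_of_mem_nhds ((hfin.subset Set.sdiff_subset).isClosed.compl_mem_nhds (by simp))
    filter_upwards [h0, self_mem_nhdsWithin] with t ht0 ht1
    have ht : t ∉ {t : ℝ | (-A).charpoly.IsRoot t} := fun h => ht0 ⟨h, ht1⟩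
    rw [isUnit_iff_ne_zero]
    intro h0
    apply ht
    simp only [Set.mem_ofPred_eq, Polynomial.IsRoot]
    rw [Matrix.eval_charpoly, ← h0]
    congr 1
    rw [sub_neg_eq_add, add_comm, Matrix.smul_one_eq_diagonal, Matrix.scalar_apply]
  have h1 := (hl.tendsto 0).mono_left (nhdsWithin_le_nhds (s := {0}ᶜ))
  have h2 := (hr.tendsto 0).mono_left (nhdsWithin_le_nhds (s := {0}ᶜ))
  have h3 := tendsto_nhds_unique_of_eventuallyEq h1 h2
    (hev.mono fun t ht => sum_weight_det_of_isUnit hn ht B)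
  simpa using h3

open scoped MatrixOrder in
theorem posSemidef_adjugate {A : Matrix (Fin n) (Fin n) ℝ} (hA : A.PosSemidef) :
    A.adjugate.PosSemidef := by
  obtain ⟨C, rfl⟩ := CStarAlgebra.nonneg_iff_eq_star_mul_self.mp hA.nonneg
  rw [Matrix.star_eq_conjTranspose, Matrix.adjugate_mul_distrib, ← Matrix.adjugate_conjTranspose]
  exact Matrix.posSemidef_self_mul_conjTranspose _

/-! ### Determinants in an orthonormal frame of the tangent space -/

/-- An orthonormal basis of `T_x S^n`. -/
def frame (x : S n) : OrthonormalBasis (Fin n) ℝ (T x) :=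
  have : Fact (Module.finrank ℝ (E n) = n + 1) := ⟨finrank_euclideanSpace_fin⟩
  OrthonormalBasis.fromOrthogonalSpanSingleton (𝕜 := ℝ) n (ne_zero_coe x)

/-- The matrix of the bilinear form `⟪A X, Y⟫` on `T_x S^n`. -/
def tanMat (A : E n →L[ℝ] E n) (x : S n) : Matrix (Fin n) (Fin n) ℝ :=
  Matrix.of fun i j => ⟪A (frame x i : E n), (frame x j : E n)⟫_ℝ

theorem inner_frame (x : S n) (i j : Fin n) :
    ⟪(frame x i : E n), (frame x j : E n)⟫_ℝ = if i = j then 1 else 0 := by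
  rw [← Submodule.coe_inner]
  exact (orthonormal_iff_ite.1 (frame x).orthonormal) i j

/-- If `A` maps the normal vector `x` to zero, then `A + 1` is block triangular with respect to
`T_x S^n` and `x`. -/
theorem det_add_one {A : E n →L[ℝ] E n} {x : S n} (hA : A (x : E n) = 0) :
    (A + 1).det = (tanMat A x + 1).det := by
  set v : Fin n ⊕ Unit → E n := Sum.elim (fun i => (frame x i : E n)) (fun _ => (x : E n)) with hv
  have hort : Orthonormal ℝ v := by
    rw [orthonormal_iff_ite]
    rintro (i | i) (j | j)
    · simp [hv, inner_frame]
    · simp [hv, real_inner_comm, inner_tangent]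
    · simp [hv, inner_tangent]
    · simp [hv]
  have hcard : Fintype.card (Fin n ⊕ Unit) = Module.finrank ℝ (E n) := by simp
  set b := basisOfOrthonormalOfCardEqFinrank hort hcard
  have hb : ⇑b = v := coe_basisOfOrthonormalOfCardEqFinrank hort hcard
  set c := b.toOrthonormalBasis (by rw [hb]; exact hort)
  have hc : ⇑c = v := by rw [Module.Basis.coe_toOrthonormalBasis, hb]
  have hmat : LinearMap.toMatrix c.toBasis c.toBasis ((A + 1 : E n →L[ℝ] E n) : E n →ₗ[ℝ] E n) =
      Matrix.fromBlocks (tanMat A x + 1).transpose 0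
        (Matrix.of fun _ j => ⟪(x : E n), A (frame x j : E n)⟫_ℝ) 1 := by
    ext i j
    rw [LinearMap.toMatrix_apply, OrthonormalBasis.coe_toBasis,
      OrthonormalBasis.coe_toBasis_repr_apply, OrthonormalBasis.repr_apply_apply, hc]
    rcases i with i | i <;> rcases j with j | j
    · simp [hv, tanMat, inner_add_right, inner_frame, Matrix.one_apply, real_inner_comm]
    · simp [hv, hA, real_inner_comm, inner_tangent]
    · simp [hv, inner_add_right, inner_tangent]
    · simp [hv, hA]
  rw [ContinuousLinearMap.det, ← LinearMap.det_toMatrix c.toBasis, hmat,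
    Matrix.det_fromBlocks_zero₁₂, Matrix.det_transpose, Matrix.det_one, mul_one]

theorem tanMat_add (A B : E n →L[ℝ] E n) (x : S n) :
    tanMat (A + B) x = tanMat A x + tanMat B x := by
  ext i j
  simp [tanMat, inner_add_left]

theorem tanMat_smul (s : ℝ) (A : E n →L[ℝ] E n) (x : S n) :
    tanMat (s • A) x = s • tanMat A x := by
  ext i j
  simp [tanMat, real_inner_smul_left]

theorem tanMat_hessOp_hom1 {f : S n → ℝ} (hf : IsC2 f) (x : S n) :
    tanMat (hessOp (hom1 f) (x : E n)) x = matH f (frame x) := by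
  ext i j
  simp only [tanMat, matH, Matrix.of_apply]
  rw [inner_hessOp, fderiv_fderiv_hom1 hf]

theorem cofactorDensity_eq_trace (h u : S n → ℝ) (x : S n) :
    cofactorDensity h u x = ((matH h (frame x)).adjugate *
      Matrix.of fun i j => grad u x (frame x i) * grad u x (frame x j)).trace := by
  rw [cofactorDensity_eq h u (frame x), cofactorIn, Matrix.trace]
  refine Finset.sum_congr rfl fun i _ => ?_
  rw [Matrix.diag_apply, Matrix.mul_apply]
  refine Finset.sum_congr rfl fun j _ => ?_
  rw [Matrix.of_apply]
  ring

theorem IsSupportFun.posSemidef_tanMat {M : ConvexBody (E n)} {N : E n → ℝ}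
    (h : IsSupportFun M N) (hN : ContDiffOn ℝ 2 N {0}ᶜ) {y : E n} (hy : y ≠ 0) (x : S n) :
    (tanMat (hessOp N y) x).PosSemidef := by
  refine Matrix.PosSemidef.of_dotProduct_mulVec_nonneg ?_ ?_
  · ext i j
    simp only [tanMat, Matrix.conjTranspose_apply, Matrix.of_apply, star_trivial]
    exact hessOp_comm hN hy _ _
  · intro v
    have := h.hessOp_nonneg hN hy (∑ i, v i • (frame x i : E n))
    refine le_of_le_of_eq this ?_
    simp only [dotProduct, Matrix.mulVec, tanMat, map_sum, map_smul, sum_inner, inner_sum,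
      real_inner_smul_left, real_inner_smul_right, Matrix.of_apply, Finset.mul_sum, star_trivial]
    rw [Finset.sum_comm]
    refine Finset.sum_congr rfl fun i _ => Finset.sum_congr rfl fun j _ => by ring

theorem IsSupportFun.det_nonneg {M : ConvexBody (E n)} {N : E n → ℝ}
    (h : IsSupportFun M N) (hN : ContDiffOn ℝ 2 N {0}ᶜ) {y : E n} (hy : y ≠ 0) :
    0 ≤ (hessOp N y + 1).det := by
  obtain ⟨x, hx⟩ := exists_eq_smul hy
  have h0 : hessOp N y (x : E n) = 0 := by
    have h1 := hessOp_apply_self hN (fun r hr y => h.smul_pos hr y) hy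
    nth_rewrite 2 [hx] at h1
    rw [map_smul] at h1
    exact (smul_eq_zero.1 h1).resolve_left (norm_ne_zero_iff.2 hy)
  rw [det_add_one h0]
  exact ((h.posSemidef_tanMat hN hy x).add Matrix.PosSemidef.one).det_nonneg

theorem cofactorDensity_nonneg {K : ConvexBody (E n)} (hK : IsC2 (supp K)) (u : S n → ℝ)
    (x : S n) : 0 ≤ cofactorDensity (supp K) u x := by
  have h := ((isSupportFun_supp K).posSemidef_tanMat (contDiffOn_hom1 hK) (ne_zero_coe x) x)
  rw [tanMat_hessOp_hom1 hK] at h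
  have h2 := (posSemidef_adjugate h).dotProduct_mulVec_nonneg
    (fun i => grad u x (frame x i))
  rw [cofactorDensity_eq _ u (frame x), cofactorIn]
  refine le_of_le_of_eq h2 ?_
  simp only [dotProduct, Matrix.mulVec, Finset.mul_sum, star_trivial]
  refine Finset.sum_congr rfl fun i _ => Finset.sum_congr rfl fun j _ => by ring

/-- The coefficient of `s ^ (n - 1)` in `det (D²(s N + N') + 1)`. -/
def mixedDet (N N' : E n → ℝ) (y : E n) : ℝ :=
  ∑ j ∈ Finset.range (n + 1),
    weight n j * (hessOp (fun y => (j : ℝ) * N y + N' y) y + 1).det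

theorem mixedDet_smul (hn : 1 ≤ n) {N N' : E n → ℝ} (hN : ContDiffOn ℝ 2 N {0}ᶜ)
    (h1 : ∀ r > 0, ∀ y, N (r • y) = r * N y) (hN' : ContDiffOn ℝ 2 N' {0}ᶜ)
    (h1' : ∀ r > 0, ∀ y, N' (r • y) = r * N' y) {r : ℝ} (hr : 0 < r) (x : S n) :
    mixedDet N N' (r • (x : E n)) = (r⁻¹) ^ (n - 1) *
      (r⁻¹ * ((tanMat (hessOp N x) x).adjugate * tanMat (hessOp N' x) x).trace +
        (tanMat (hessOp N x) x).adjugate.trace) := by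
  have hx := ne_zero_coe x
  have hrx : r • (x : E n) ≠ 0 := smul_ne_zero hr.ne' hx
  have hdet : ∀ s : ℝ, (hessOp (fun y => s * N y + N' y) (r • (x : E n)) + 1).det =
      (s • (r⁻¹ • tanMat (hessOp N x) x) + (r⁻¹ • tanMat (hessOp N' x) x + 1)).det := by
    intro s
    rw [hessOp_smul_add hN hN' s hrx, hessOp_smul_pos h1 hr, hessOp_smul_pos h1' hr, det_add_one]
    · rw [tanMat_add, tanMat_smul, tanMat_smul, tanMat_smul, add_assoc]
    · simp [hessOp_apply_self hN h1 hx, hessOp_apply_self hN' h1' hx]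
  simp only [mixedDet, hdet]
  rw [sum_weight_det hn, Matrix.adjugate_smul, Fintype.card_fin, Matrix.smul_mul,
    Matrix.trace_smul, smul_eq_mul, Matrix.mul_add, Matrix.mul_smul, Matrix.mul_one,
    Matrix.trace_add, Matrix.trace_smul, smul_eq_mul]

theorem continuousOn_mixedDet {N N' : E n → ℝ} (hN : ContDiffOn ℝ 2 N {0}ᶜ)
    (hN' : ContDiffOn ℝ 2 N' {0}ᶜ) : ContinuousOn (mixedDet N N') {0}ᶜ := by
  refine continuousOn_finsetSum _ fun j _ => continuousOn_const.mul ?_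
  refine ContinuousLinearMap.continuous_det.comp_continuousOn ?_
  exact (continuousOn_hessOp ((contDiffOn_const.mul hN).add hN')).add continuousOn_const

/-! ### Integrals over parallel sets -/

/-- The integral of `ψ` along the outer normal vectors `x - nearest M x` of `M`. -/
def normalIntegral (M : ConvexBody (E n)) (ψ : E n → ℝ) : ℝ := ∫ x, ψ (x - nearest M x)

/-- The continuous tent function supported in `[1, 3]` with peak at `2`. -/
def tent (r : ℝ) : ℝ := max 0 (1 - |r - 2|)

theorem continuous_tent : Continuous tent := by unfold tent; fun_prop

theorem tent_nonneg (r : ℝ) : 0 ≤ tent r := le_max_left _ _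

theorem tent_le_one (r : ℝ) : tent r ≤ 1 :=
  max_le zero_le_one (by linarith [abs_nonneg (r - 2)])

theorem tent_of_le {r : ℝ} (h : r ≤ 1) : tent r = 0 :=
  max_eq_left (by linarith [neg_abs_le (r - 2)])

theorem tent_of_ge {r : ℝ} (h : 3 ≤ r) : tent r = 0 :=
  max_eq_left (by linarith [le_abs_self (r - 2)])

theorem continuous_tent_mul {ξ : E n → ℝ} (hξ : ContinuousOn ξ {0}ᶜ) :
    Continuous fun y => tent ‖y‖ * ξ y := by
  refine continuous_iff_continuousAt.2 fun y => ?_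
  by_cases hy : y = 0
  · subst hy
    refine (continuousAt_const (y := (0 : ℝ))).congr_of_eventuallyEq ?_
    filter_upwards [ball_mem_nhds (0 : E n) one_pos] with z hz
    rw [tent_of_le (by simpa using (mem_ball_zero_iff.1 hz).le), zero_mul]
  · exact (continuous_tent.comp continuous_norm).continuousAt.mul
      (hξ.continuousAt (isOpen_compl_singleton.mem_nhds hy))

theorem tent_mul_eq_zero (ξ : E n → ℝ) {y : E n} (hy : 3 ≤ ‖y‖) : tent ‖y‖ * ξ y = 0 := by
  rw [tent_of_ge hy, zero_mul]

theorem hasCompactSupport_tent_mul (ξ : E n → ℝ) :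
    HasCompactSupport fun y => tent ‖y‖ * ξ y := by
  refine HasCompactSupport.intro (isCompact_closedBall (0 : E n) 3) fun y hy => ?_
  exact tent_mul_eq_zero ξ (by simpa using (not_le.1 (mt mem_closedBall_zero_iff.2 hy)).le)

theorem integrable_tent_mul {ξ : E n → ℝ} (hξ : ContinuousOn ξ {0}ᶜ) :
    Integrable fun y => tent ‖y‖ * ξ y :=
  (continuous_tent_mul hξ).integrable_of_hasCompactSupport (hasCompactSupport_tent_mul ξ)

theorem norm_normal_ge {M : ConvexBody (E n)} {R : ℝ} (hR : ∀ z ∈ M, ‖z‖ ≤ R) {x : E n}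
    (hx : R + 3 < ‖x‖) : 3 ≤ ‖x - nearest M x‖ := by
  have := hR _ (nearest_mem M x)
  have := norm_sub_norm_le x (nearest M x)
  linarith

theorem norm_comp_normal_le {M : ConvexBody (E n)} {R C : ℝ} (hR : ∀ z ∈ M, ‖z‖ ≤ R)
    {ψ : E n → ℝ} (hC : ∀ y, |ψ y| ≤ C) (h0 : ∀ y, 3 ≤ ‖y‖ → ψ y = 0) (x : E n) :
    ‖ψ (x - nearest M x)‖ ≤ (closedBall (0 : E n) (R + 3)).indicator (fun _ => C) x := by
  by_cases hx : x ∈ closedBall (0 : E n) (R + 3)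
  · rw [Set.indicator_of_mem hx]
    exact hC _
  · rw [Set.indicator_of_notMem hx, h0 _ (norm_normal_ge hR (by simpa using hx)), norm_zero]

theorem integrable_indicator_closedBall (R C : ℝ) :
    Integrable ((closedBall (0 : E n) R).indicator (fun _ => C)) :=
  (integrable_indicator_iff measurableSet_closedBall).2
    (integrableOn_const (measure_closedBall_lt_top.ne))

theorem abs_normalIntegral_le {M : ConvexBody (E n)} {R C : ℝ} (hR : ∀ z ∈ M, ‖z‖ ≤ R)
    {ψ : E n → ℝ} (hC : ∀ y, |ψ y| ≤ C) (h0 : ∀ y, 3 ≤ ‖y‖ → ψ y = 0) :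
    |normalIntegral M ψ| ≤ C * volume.real (closedBall (0 : E n) (R + 3)) := by
  have h := norm_integral_le_of_norm_le (integrable_indicator_closedBall (R + 3) C)
    (Filter.Eventually.of_forall (norm_comp_normal_le hR hC h0))
  rw [integral_indicator measurableSet_closedBall, setIntegral_const, smul_eq_mul, mul_comm] at h
  exact h

theorem exists_norm_le (M : ConvexBody (E n)) : ∃ R, ∀ z ∈ M, ‖z‖ ≤ R :=
  M.isBounded.exists_norm_le

/-- Integrals along outer normal vectors are continuous in the Hausdorff metric. -/
theorem tendsto_normalIntegral {Mi : ℕ → ConvexBody (E n)} {M : ConvexBody (E n)}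
    (h : Tendsto Mi atTop (𝓝 M)) {ψ : E n → ℝ} (hψ : Continuous ψ)
    (h0 : ∀ y, 3 ≤ ‖y‖ → ψ y = 0) :
    Tendsto (fun i => normalIntegral (Mi i) ψ) atTop (𝓝 (normalIntegral M ψ)) := by
  have hcs : HasCompactSupport ψ := by
    refine HasCompactSupport.intro (isCompact_closedBall (0 : E n) 3) fun y hy => h0 y ?_
    simpa using (not_le.1 (mt mem_closedBall_zero_iff.2 hy)).le
  obtain ⟨C, hC⟩ := hcs.exists_bound_of_continuous hψ
  obtain ⟨R, hR⟩ := exists_norm_le M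
  refine tendsto_integral_filter_of_dominated_convergence
    ((closedBall (0 : E n) (R + 1 + 3)).indicator (fun _ => C)) ?_ ?_
    (integrable_indicator_closedBall _ C) ?_
  · exact Filter.Eventually.of_forall fun i =>
      (hψ.comp (continuous_id.sub (continuous_nearest _))).aestronglyMeasurable
  · filter_upwards [Metric.tendsto_nhds.1 h 1 one_pos] with i hi
    refine Filter.Eventually.of_forall (norm_comp_normal_le (fun z hz => ?_) hC h0)
    obtain ⟨z', hz', hd⟩ := exists_norm_sub_le hi hz
    have := hR z' hz'
    have := norm_sub_norm_le z z'
    linarith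
  · exact Filter.Eventually.of_forall fun x =>
      (hψ.tendsto _).comp (tendsto_const_nhds.sub (tendsto_nearest h x))

/-- For a smooth body, the interpolated integral along the normal vectors of the bodies
`j K + L` is an integral against the mixed determinant. -/
theorem sum_normalIntegral {K L : ConvexBody (E n)} {N N' ξ : E n → ℝ} (hK : IsSupportFun K N)
    (hL : IsSupportFun L N') (hN : ContDiffOn ℝ 2 N {0}ᶜ) (hN' : ContDiffOn ℝ 2 N' {0}ᶜ)
    (hξ : ContinuousOn ξ {0}ᶜ) :
    ∑ j ∈ Finset.range (n + 1), weight n j *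
        normalIntegral ((j : ℝ) • K + L) (fun y => tent ‖y‖ * ξ y) =
      ∫ y in {0}ᶜ, tent ‖y‖ * (mixedDet N N' y * ξ y) := by
  have hdet : ∀ s : ℝ, ContinuousOn
      (fun y => (hessOp (fun y => s * N y + N' y) y + 1).det * ξ y) {0}ᶜ := by
    intro s
    refine ContinuousOn.mul ?_ hξ
    refine ContinuousLinearMap.continuous_det.comp_continuousOn ?_
    exact (continuousOn_hessOp ((contDiffOn_const.mul hN).add hN')).add continuousOn_const
  have h1 : ∀ j ∈ Finset.range (n + 1), weight n j *
        normalIntegral ((j : ℝ) • K + L) (fun y => tent ‖y‖ * ξ y) =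
      ∫ y in {0}ᶜ, weight n j *
        (tent ‖y‖ * ((hessOp (fun y => (j : ℝ) * N y + N' y) y + 1).det * ξ y)) := by
    intro j _
    have hsup := hK.smul_add hL (Nat.cast_nonneg j)
    have hC2 : ContDiffOn ℝ 2 (fun y => (j : ℝ) * N y + N' y) {0}ᶜ :=
      (contDiffOn_const.mul hN).add hN'
    rw [normalIntegral, hsup.integral_comp_sub_nearest (ψ := fun y => tent ‖y‖ * ξ y) hC2
      (by rw [tent_of_le (by simp), zero_mul]), integral_const_mul]
    congr 1
    refine setIntegral_congr_fun (measurableSet_singleton 0).compl fun y hy => ?_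
    rw [abs_of_nonneg (hsup.det_nonneg hC2 hy)]
    ring
  rw [Finset.sum_congr rfl h1, ← integral_finsetSum]
  · refine integral_congr_ae (Filter.Eventually.of_forall fun y => ?_)
    simp only [mixedDet, Finset.sum_mul, Finset.mul_sum]
    exact Finset.sum_congr rfl fun j _ => by ring
  · intro j _
    exact ((integrable_tent_mul (hdet j)).const_mul _).integrableOn

/-! ### Polar coordinates -/

/-- The integral of `tent r * r ^ (1 - n)` against `r ^ n dr` on the half-line: the factor which
polar coordinates contribute to `cofactorFunctional`. -/
def radialMass (n : ℕ) : ℝ :=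
  ∫ r : Set.Ioi (0 : ℝ), tent r * ((r : ℝ)⁻¹) ^ (n - 1) ∂(Measure.volumeIoiPow n)

theorem integral_polar (k : ℝ → ℝ) (ξ : S n → ℝ) :
    ∫ y in ({0}ᶜ : Set (E n)), k ‖y‖ * ext0 ξ y =
      (∫ r : Set.Ioi (0 : ℝ), k r ∂(Measure.volumeIoiPow n)) * ∫ x, ξ x ∂(dS n) := by
  have hmp := (volume : Measure (E n)).measurePreserving_homeomorphUnitSphereProd
  rw [finrank_euclideanSpace_fin, Nat.add_sub_cancel] at hmp
  have h1 := hmp.integral_comp (homeomorphUnitSphereProd (E n)).measurableEmbedding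
    (fun z : S n × Set.Ioi (0 : ℝ) => ξ z.1 * k z.2)
  rw [integral_prod_mul (fun x : S n => ξ x) (fun r : Set.Ioi (0 : ℝ) => k r)] at h1
  rw [mul_comm, dS, ← h1, ← integral_subtype_comap (measurableSet_singleton 0).compl]
  refine integral_congr_ae (Filter.Eventually.of_forall fun y => ?_)
  have hy : (y : E n) ≠ 0 := y.2
  simp only [homeomorphUnitSphereProd_apply_snd_coe]
  rw [mul_comm]
  congr 1
  refine ext0_eq (norm_pos_iff.2 hy) ?_
  rw [homeomorphUnitSphereProd_apply_fst_coe, smul_smul, mul_inv_cancel₀ (norm_ne_zero_iff.2 hy),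
    one_smul]

theorem radialMass_ne_zero (n : ℕ) : radialMass n ≠ 0 := by
  intro h0
  have h1 := integral_polar (n := n) (fun r => tent r * (r⁻¹) ^ (n - 1)) (fun _ => 1)
  rw [show (∫ r : Set.Ioi (0 : ℝ), tent r * ((r : ℝ)⁻¹) ^ (n - 1) ∂(Measure.volumeIoiPow n)) = 0
    from h0, zero_mul] at h1
  have hc : ContinuousOn (fun y : E n => (‖y‖⁻¹) ^ (n - 1)) {0}ᶜ :=
    (contDiffOn_norm_inv (n := n)).continuousOn.pow _
  have h2 : ∫ y in ({0}ᶜ : Set (E n)), tent ‖y‖ * (‖y‖⁻¹) ^ (n - 1) * ext0 (fun _ => 1) y =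
      ∫ y : E n, tent ‖y‖ * (‖y‖⁻¹) ^ (n - 1) := by
    rw [← setIntegral_eq_integral_of_forall_compl_eq_zero (s := ({0}ᶜ : Set (E n)))
      (f := fun y => tent ‖y‖ * (‖y‖⁻¹) ^ (n - 1))]
    · refine setIntegral_congr_fun (measurableSet_singleton 0).compl fun y hy => ?_
      have hy : y ≠ 0 := hy
      simp [ext0, hy]
    · intro y hy
      rw [not_not.1 hy, tent_of_le (by simp), zero_mul]
  rw [h2] at h1
  have hpos : 0 < ∫ y : E n, tent ‖y‖ * (‖y‖⁻¹) ^ (n - 1) := by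
    refine (continuous_tent_mul hc).integral_pos_of_hasCompactSupport_nonneg_nonzero
      (hasCompactSupport_tent_mul _) (fun y => mul_nonneg (tent_nonneg _) (by positivity))
      (x := EuclideanSpace.single 0 2) ?_
    simp [tent]
  exact hpos.ne' h1

/-! ### The functional -/

/-- The integral of `φ` against `U^{ij} u_i u_j dS`, written without derivatives of the support
function of `K`. Here `L₁` and `L₂` have the support functions `u ^ 2 / 2 + c` and `u + c`.
The factors `‖y‖` compensate the factor `‖y‖⁻¹` of the Hessians of the support functions of `L₁` and
`L₂`. The last summand, with the support function zero, removes all multiples of the identity, both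
those of `grad_mul_grad` and those that come from the unit ball in the change of variables. -/
def cofactorFunctional (K L₁ L₂ : ConvexBody (E n)) (c : ℝ) (u φ : S n → ℝ) : ℝ :=
  (∑ j ∈ Finset.range (n + 1), weight n j *
      normalIntegral ((j : ℝ) • K + L₁) (fun y => tent ‖y‖ * (‖y‖ * ext0 φ y)) -
    ∑ j ∈ Finset.range (n + 1), weight n j *
      normalIntegral ((j : ℝ) • K + L₂) (fun y => tent ‖y‖ * (‖y‖ * ext0 φ y * ext0 u y)) +
    ∑ j ∈ Finset.range (n + 1), weight n j *
      normalIntegral ((j : ℝ) • K + 0) (fun y => tent ‖y‖ *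
        (ext0 φ y * (ext0 u y ^ 2 / 2 - (c + ‖y‖) * (1 - ext0 u y))))) / radialMass n

theorem continuousOn_ext0 {f : S n → ℝ} (hf : Continuous f) : ContinuousOn (ext0 f) {0}ᶜ := by
  rw [continuousOn_iff_continuous_domRestrict]
  have h : ∀ y : ({0}ᶜ : Set (E n)), ‖(y : E n)‖⁻¹ • (y : E n) ∈ sphere (0 : E n) 1 := fun y => by
    have : ‖(y : E n)‖ ≠ 0 := norm_ne_zero_iff.2 y.2
    simp [norm_smul, this]
  have hc : Continuous fun y : ({0}ᶜ : Set (E n)) => ‖(y : E n)‖⁻¹ • (y : E n) :=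
    (continuous_subtype_val.norm.inv₀ fun y => norm_ne_zero_iff.2 y.2).smul continuous_subtype_val
  refine (hf.comp (hc.subtype_mk h)).congr fun y => ?_
  have hy : (y : E n) ≠ 0 := y.2
  simp only [Set.domRestrict_apply, ext0, dif_neg hy, Function.comp_apply]

theorem tendsto_cofactorFunctional {Ki : ℕ → ConvexBody (E n)} {K : ConvexBody (E n)}
    (h : Tendsto Ki atTop (𝓝 K)) (L₁ L₂ : ConvexBody (E n)) (c : ℝ) {u φ : S n → ℝ}
    (hu : Continuous u) (hφ : Continuous φ) :
    Tendsto (fun i => cofactorFunctional (Ki i) L₁ L₂ c u φ) atTop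
      (𝓝 (cofactorFunctional K L₁ L₂ c u φ)) := by
  have hu' := continuousOn_ext0 hu
  have hφ' := continuousOn_ext0 hφ
  have key : ∀ (L : ConvexBody (E n)) (ξ : E n → ℝ), ContinuousOn ξ {0}ᶜ →
      Tendsto (fun i => ∑ j ∈ Finset.range (n + 1), weight n j *
        normalIntegral ((j : ℝ) • Ki i + L) (fun y => tent ‖y‖ * ξ y)) atTop
      (𝓝 (∑ j ∈ Finset.range (n + 1), weight n j *
        normalIntegral ((j : ℝ) • K + L) (fun y => tent ‖y‖ * ξ y))) := by
    intro L ξ hξ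
    refine tendsto_finsetSum _ fun j _ => Tendsto.const_mul _ ?_
    exact tendsto_normalIntegral (tendsto_smul_add h _ L) (continuous_tent_mul hξ)
      fun y hy => tent_mul_eq_zero ξ hy
  exact (((key L₁ _ (by fun_prop)).sub (key L₂ _ (by fun_prop))).add
    (key 0 _ (by fun_prop))).div_const _

section SmoothBody

variable {K L₁ L₂ : ConvexBody (E n)} {c : ℝ} {u : S n → ℝ}

/-- The combination of mixed determinants that yields `U^{ij} u_i u_j`. -/
theorem mixedDet_combination (hn : 1 ≤ n) (hK : IsC2 (supp K)) (hu : IsC2 u) (c : ℝ) {r : ℝ}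
    (hr : 0 < r) (x : S n) :
    r * mixedDet (hom1 (supp K)) (hom1 fun x => u x ^ 2 / 2 + c) (r • (x : E n))
      - r * u x * mixedDet (hom1 (supp K)) (hom1 fun x => u x + c) (r • (x : E n))
      + (u x ^ 2 / 2 - (c + r) * (1 - u x)) *
        mixedDet (hom1 (supp K)) (fun _ => 0) (r • (x : E n)) =
      (r⁻¹) ^ (n - 1) * cofactorDensity (supp K) u x := by
  have hN := contDiffOn_hom1 hK
  have h1 := hom1_smul_pos (supp K)
  have hz : hessOp (fun _ : E n => (0 : ℝ)) (x : E n) = 0 := by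
    simp [hessOp, fderiv_fun_const]
  have hz' : tanMat (0 : E n →L[ℝ] E n) x = 0 := by ext i j; simp [tanMat]
  rw [mixedDet_smul hn hN h1 (contDiffOn_hom1 (hu.half_sq.add_const c)) (hom1_smul_pos _) hr,
    mixedDet_smul hn hN h1 (contDiffOn_hom1 (hu.add_const c)) (hom1_smul_pos _) hr,
    mixedDet_smul hn hN h1 contDiffOn_const (by simp) hr, hz, hz',
    tanMat_hessOp_hom1 (hu.half_sq.add_const c), tanMat_hessOp_hom1 (hu.add_const c),
    tanMat_hessOp_hom1 hK, cofactorDensity_eq_trace]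
  have hG : (Matrix.of fun i j => grad u x (frame x i) * grad u x (frame x j)) =
      matH (fun x => u x ^ 2 / 2 + c) (frame x) - u x • matH (fun x => u x + c) (frame x)
        - (c - u x ^ 2 / 2 - u x * c) • (1 : Matrix (Fin n) (Fin n) ℝ) := by
    ext i j
    simp only [Matrix.of_apply, Matrix.sub_apply, Matrix.smul_apply, matH, smul_eq_mul,
      Matrix.one_apply]
    rw [grad_mul_grad hu c, Submodule.coe_inner, inner_frame]
  rw [hG]
  simp only [Matrix.mul_sub, Matrix.mul_smul, Matrix.mul_one, Matrix.mul_zero, Matrix.trace_sub,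
    Matrix.trace_smul, Matrix.trace_zero, smul_eq_mul]
  field_simp
  ring

theorem continuous_cofactorDensity (hn : 1 ≤ n) (hK : IsC2 (supp K)) (hu : IsC2 u) :
    Continuous (cofactorDensity (supp K) u) := by
  have h := fun x => mixedDet_combination hn hK hu 0 one_pos x
  simp only [inv_one, one_pow, one_mul, one_smul] at h
  rw [show cofactorDensity (supp K) u = _ from funext fun x => (h x).symm]
  have hN := contDiffOn_hom1 hK
  have key : ∀ N' : E n → ℝ, ContDiffOn ℝ 2 N' {0}ᶜ →
      Continuous fun x : S n => mixedDet (hom1 (supp K)) N' (x : E n) := fun N' hN' =>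
    (continuousOn_mixedDet hN hN').comp_continuous continuous_subtype_val fun x => ne_zero_coe x
  have k1 := key _ (contDiffOn_hom1 (hu.half_sq.add_const 0))
  have k2 := key _ (contDiffOn_hom1 (hu.add_const 0))
  have k0 := key (fun _ => 0) contDiffOn_const
  have hu' := hu.continuous
  fun_prop

theorem cofactorFunctional_eq_integral (hn : 1 ≤ n) (hK : IsC2 (supp K)) (hu : IsC2 u)
    (h₁ : IsSupportFun L₁ (hom1 fun x => u x ^ 2 / 2 + c))
    (h₂ : IsSupportFun L₂ (hom1 fun x => u x + c)) {φ : S n → ℝ} (hφ : Continuous φ) :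
    cofactorFunctional K L₁ L₂ c u φ = ∫ x, φ x * cofactorDensity (supp K) u x ∂(dS n) := by
  have hN := contDiffOn_hom1 hK
  have hS := isSupportFun_supp K
  have hN₁ := contDiffOn_hom1 (hu.half_sq.add_const c)
  have hN₂ := contDiffOn_hom1 (hu.add_const c)
  have hN₀ : ContDiffOn ℝ 2 (fun _ : E n => (0 : ℝ)) {0}ᶜ := contDiffOn_const
  have hu' := continuousOn_ext0 hu.continuous
  have hφ' := continuousOn_ext0 hφ
  have c₁ : ContinuousOn (fun y => ‖y‖ * ext0 φ y) {0}ᶜ := by fun_prop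
  have c₂ : ContinuousOn (fun y => ‖y‖ * ext0 φ y * ext0 u y) {0}ᶜ := by fun_prop
  have c₀ : ContinuousOn (fun y => ext0 φ y * (ext0 u y ^ 2 / 2 - (c + ‖y‖) * (1 - ext0 u y)))
    {0}ᶜ := by fun_prop
  have i₁ := (integrable_tent_mul ((continuousOn_mixedDet hN hN₁).mul c₁)).integrableOn (s := {0}ᶜ)
  have i₂ := (integrable_tent_mul ((continuousOn_mixedDet hN hN₂).mul c₂)).integrableOn (s := {0}ᶜ)
  have i₀ := (integrable_tent_mul ((continuousOn_mixedDet hN hN₀).mul c₀)).integrableOn (s := {0}ᶜ)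
  rw [cofactorFunctional, sum_normalIntegral hS h₁ hN hN₁ c₁, sum_normalIntegral hS h₂ hN hN₂ c₂,
    sum_normalIntegral hS IsSupportFun.zero hN hN₀ c₀, div_eq_iff (radialMass_ne_zero n),
    mul_comm (∫ x, _ ∂(dS n)), radialMass,
    ← integral_polar (fun r => tent r * (r⁻¹) ^ (n - 1))
      fun x => φ x * cofactorDensity (supp K) u x]
  have e := (integral_add (i₁.sub i₂) i₀).symm
  have e' := integral_sub i₁ i₂
  simp only [Pi.sub_apply] at e
  rw [e'] at e
  refine e.trans ?_
  refine setIntegral_congr_fun (measurableSet_singleton 0).compl fun y hy => ?_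
  obtain ⟨x, hx⟩ := exists_eq_smul hy
  have hr : 0 < ‖y‖ := norm_pos_iff.2 hy
  have hcomb := mixedDet_combination hn hK hu c hr x
  rw [← hx] at hcomb
  simp only [Pi.mul_apply, ext0_eq hr hx]
  linear_combination (tent ‖y‖ * φ x) * hcomb

theorem isFiniteMeasure_cofactorMeasure (hn : 1 ≤ n) (hK : IsC2 (supp K)) (hu : IsC2 u) :
    IsFiniteMeasure (cofactorMeasure K u) := by
  have : IsFiniteMeasure (dS n) := inferInstanceAs (IsFiniteMeasure (Measure.toSphere _))
  exact isFiniteMeasure_withDensity_ofReal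
    (((continuous_cofactorDensity hn hK hu).integrable_of_hasCompactSupport
      (HasCompactSupport.of_compactSpace _)).hasFiniteIntegral)

theorem integral_cofactorMeasure (hn : 1 ≤ n) (hK : IsC2 (supp K)) (hu : IsC2 u)
    (h₁ : IsSupportFun L₁ (hom1 fun x => u x ^ 2 / 2 + c))
    (h₂ : IsSupportFun L₂ (hom1 fun x => u x + c)) {φ : S n → ℝ} (hφ : Continuous φ) :
    ∫ x, φ x ∂(cofactorMeasure K u) = cofactorFunctional K L₁ L₂ c u φ := by
  have hc := continuous_cofactorDensity hn hK hu
  rw [cofactorFunctional_eq_integral hn hK hu h₁ h₂ hφ, cofactorMeasure,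
    integral_withDensity_eq_integral_toReal_smul hc.measurable.ennreal_ofReal
      (Filter.Eventually.of_forall fun x => ENNReal.ofReal_lt_top)]
  refine integral_congr_ae (Filter.Eventually.of_forall fun x => ?_)
  simp only
  rw [ENNReal.toReal_ofReal (cofactorDensity_nonneg hK u x), smul_eq_mul, mul_comm]

end SmoothBody

/-! ### Bodies with a given support function -/

theorem norm_le_of_isSupportFun {M : ConvexBody (E n)} {N : E n → ℝ} (h : IsSupportFun M N)
    {R : ℝ} (hR0 : 0 ≤ R) (hR : ∀ x : S n, N x ≤ R) : ∀ z ∈ M, ‖z‖ ≤ R := by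
  intro z hz
  by_cases h0 : z = 0
  · simpa [h0] using hR0
  obtain ⟨x, hx⟩ := exists_eq_smul h0
  have h1 := h.le x z hz
  rw [hx, real_inner_smul_right, real_inner_self_eq_norm_sq, norm_coe] at h1
  linarith [hR x]

theorem exists_sphere (n : ℕ) : Nonempty (S n) :=
  ⟨⟨EuclideanSpace.single 0 1, by simp⟩⟩

/-- A one-homogeneous function which is a supremum of linear functions, attained at each point of
the sphere, is the support function of a convex body. -/
theorem exists_body {N : E n → ℝ} (h1 : ∀ r > 0, ∀ y, N (r • y) = r * N y) (h0 : N 0 = 0) {R : ℝ}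
    (hR : ∀ x : S n, N x ≤ R)
    (hex : ∀ x : S n, ∃ z : E n, ⟪(x : E n), z⟫_ℝ = N x ∧ ∀ w, ⟪w, z⟫_ℝ ≤ N w) :
    ∃ L : ConvexBody (E n), IsSupportFun L N := by
  obtain ⟨x₀⟩ := exists_sphere n
  let s : Set (E n) := {z | ∀ w, ⟪w, z⟫_ℝ ≤ N w}
  have hcl : IsClosed s := by
    have : s = ⋂ w, {z : E n | ⟪w, z⟫_ℝ ≤ N w} := by ext; simp [s]
    rw [this]
    exact isClosed_iInter fun w => isClosed_le (by fun_prop) continuous_const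
  have hbd : s ⊆ closedBall 0 (max R 0) := by
    intro z hz
    rw [mem_closedBall_zero_iff]
    by_cases hz0 : z = 0
    · simp [hz0]
    obtain ⟨x, hx⟩ := exists_eq_smul hz0
    have h := hz (x : E n)
    rw [hx, real_inner_smul_right, real_inner_self_eq_norm_sq, norm_coe] at h
    exact (by linarith [hR x] : ‖z‖ ≤ R).trans (le_max_left _ _)
  have hconv : Convex ℝ s := by
    intro z hz z' hz' a b ha hb hab w
    rw [inner_add_right, real_inner_smul_right, real_inner_smul_right]
    have e1 := mul_le_mul_of_nonneg_left (hz w) ha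
    have e2 := mul_le_mul_of_nonneg_left (hz' w) hb
    calc _ ≤ a * N w + b * N w := add_le_add e1 e2
      _ = N w := by rw [← add_mul, hab, one_mul]
  have hne : s.Nonempty := (hex x₀).imp fun z hz => hz.2
  refine ⟨⟨s, hconv, (isCompact_closedBall 0 _).of_isClosed_subset hcl hbd, hne⟩,
    fun y z hz => hz y, fun y => ?_⟩
  by_cases hy : y = 0
  · obtain ⟨z, hz⟩ := hne
    exact ⟨z, hz, by simp [hy, h0]⟩
  · obtain ⟨x, hx⟩ := exists_eq_smul hy
    obtain ⟨z, hz, hz'⟩ := hex x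
    exact ⟨z, hz', by rw [hx, real_inner_smul_left, hz, h1 _ (norm_pos_iff.2 hy)]⟩

/-- Every point `w` lies on a great circle through `x`. The tangent vector is arbitrary if
`w = ± x`, which requires `n ≥ 1`. -/
theorem exists_tangent_decomposition (hn : 1 ≤ n) (x w : S n) :
    ∃ X : T x, ‖(X : E n)‖ = 1 ∧ ∃ θ ∈ Set.Icc 0 Real.pi,
      (w : E n) = Real.cos θ • (x : E n) + Real.sin θ • (X : E n) := by
  set a := ⟪(x : E n), (w : E n)⟫_ℝ with ha
  set v : E n := w - a • (x : E n) with hv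
  have hxx : ⟪(x : E n), (x : E n)⟫_ℝ = 1 := by rw [real_inner_self_eq_norm_sq]; simp
  have hvx : ⟪(x : E n), v⟫_ℝ = 0 := by
    rw [hv, inner_sub_right, real_inner_smul_right, hxx, ← ha]; ring
  have hvT : v ∈ T x := Submodule.mem_orthogonal_singleton_iff_inner_right.2 hvx
  have hw : (w : E n) = a • (x : E n) + v := by rw [hv]; abel
  have hnorm : a ^ 2 + ‖v‖ ^ 2 = 1 := by
    have h1 : ‖(w : E n)‖ ^ 2 = 1 := by simp
    rw [hw, norm_add_sq_real, real_inner_smul_left, hvx, norm_smul, norm_coe] at h1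
    simpa using h1
  have ha1 : -1 ≤ a ∧ a ≤ 1 := abs_le.1 (abs_le_one_iff_mul_self_le_one.2 (by
    nlinarith [sq_nonneg ‖v‖]))
  have hsin : Real.sin (Real.arccos a) = ‖v‖ := by
    rw [Real.sin_arccos, ← Real.sqrt_sq (norm_nonneg v)]
    congr 1
    linarith
  have hθ : Real.arccos a ∈ Set.Icc 0 Real.pi := ⟨Real.arccos_nonneg a, Real.arccos_le_pi a⟩
  by_cases h0 : v = 0
  · refine ⟨frame x ⟨0, hn⟩, ?_, _, hθ, ?_⟩
    · rw [Submodule.norm_coe, (frame x).norm_eq_one]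
    · rw [hsin, h0, norm_zero, zero_smul, Real.cos_arccos ha1.1 ha1.2, hw, h0]
  · have hv0 : ‖v‖ ≠ 0 := norm_ne_zero_iff.2 h0
    refine ⟨⟨‖v‖⁻¹ • v, Submodule.smul_mem _ _ hvT⟩, by simp [norm_smul, hv0], _, hθ, ?_⟩
    rw [hsin, Real.cos_arccos ha1.1 ha1.2, smul_smul, mul_inv_cancel₀ hv0, one_smul, ← hw]

/-- Sturm comparison along great circles: if `∇²f + f Id ≥ 0`, the one-homogeneous extension of
`f` lies above its tangent planes. -/
theorem fderiv_hom1_le (hn : 1 ≤ n) {f : S n → ℝ} (hf : IsC2 f)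
    (hpos : ∀ (x : S n) (X : T x), 0 ≤ formH f x X X) (x w : S n) :
    fderiv ℝ (hom1 f) (x : E n) (w : E n) ≤ f w := by
  obtain ⟨X, hX, θ, hθ, hw⟩ := exists_tangent_decomposition hn x w
  have hN := contDiffOn_hom1 hf
  set N := hom1 f with hNdef
  let γ : ℝ → E n := fun s => Real.cos s • (x : E n) + Real.sin s • (X : E n)
  let τ : ℝ → E n := fun s => (-Real.sin s) • (x : E n) + Real.cos s • (X : E n)
  have hxx : ⟪(x : E n), (x : E n)⟫_ℝ = 1 := by rw [real_inner_self_eq_norm_sq]; simp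
  have hXX : ⟪(X : E n), (X : E n)⟫_ℝ = 1 := by rw [real_inner_self_eq_norm_sq, hX]; simp
  have hxX := inner_tangent x X
  have hXx : ⟪(X : E n), (x : E n)⟫_ℝ = 0 := by rw [real_inner_comm, hxX]
  have hγS : ∀ s, γ s ∈ sphere (0 : E n) 1 := by
    intro s
    have h1 : ⟪γ s, γ s⟫_ℝ = 1 := by
      simp only [γ, inner_add_left, inner_add_right, real_inner_smul_left, real_inner_smul_right,
        hxx, hXX, hxX, hXx]
      linear_combination Real.sin_sq_add_cos_sq s
    rw [real_inner_self_eq_norm_sq] at h1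
    rw [mem_sphere_zero_iff_norm]
    nlinarith [norm_nonneg (γ s)]
  have hτT : ∀ s, τ s ∈ T (⟨γ s, hγS s⟩ : S n) := by
    intro s
    refine Submodule.mem_orthogonal_singleton_iff_inner_right.2 ?_
    simp only [γ, τ, inner_add_left, inner_add_right, real_inner_smul_left, real_inner_smul_right,
      hxx, hXX, hxX, hXx]
    ring
  have hγ0 : ∀ s, γ s ≠ 0 := fun s => ne_zero_of_mem_unit_sphere ⟨γ s, hγS s⟩
  have hγ : ∀ s, HasDerivAt γ (τ s) s := fun s =>
    ((Real.hasDerivAt_cos s).smul_const (x : E n)).add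
      ((Real.hasDerivAt_sin s).smul_const (X : E n))
  have hτ : ∀ s, HasDerivAt τ (-γ s) s := fun s => by
    have := ((Real.hasDerivAt_sin s).neg.smul_const (x : E n)).add
      ((Real.hasDerivAt_cos s).smul_const (X : E n))
    refine this.congr_deriv ?_
    simp only [γ, neg_add, neg_smul]
  have hg : ∀ s, HasDerivAt (fun s => N (γ s)) (fderiv ℝ N (γ s) (τ s)) s := fun s =>
    (differentiableAt_of_ne hN (hγ0 s)).hasFDerivAt.comp_hasDerivAt s (hγ s)
  have hg' : ∀ s, HasDerivAt (fun s => fderiv ℝ N (γ s) (τ s))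
      (fderiv ℝ (fderiv ℝ N) (γ s) (τ s) (τ s) - N (γ s)) s := by
    intro s
    have h1 := ((hasFDerivAt_fderiv_of_ne hN (hγ0 s)).comp_hasDerivAt s (hγ s)).clm_apply (hτ s)
    refine h1.congr_deriv ?_
    rw [map_neg, Function.comp_apply, fderiv_apply_self hN (hom1_smul_pos f) (hγ0 s)]
    rfl
  -- with `g s = N (γ s)`, the derivative of `W = g' sin (θ - ·) + g cos (θ - ·)` is
  -- `(g'' + g) sin (θ - ·)`, and `g'' + g` is the value of `∇²f + f Id` on `γ'`
  let W : ℝ → ℝ := fun s =>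
    fderiv ℝ N (γ s) (τ s) * Real.sin (θ - s) + N (γ s) * Real.cos (θ - s)
  have hW : ∀ s, HasDerivAt W (fderiv ℝ (fderiv ℝ N) (γ s) (τ s) (τ s) * Real.sin (θ - s)) s := by
    intro s
    have hs : HasDerivAt (fun s => θ - s) (-1) s := by
      simpa using (hasDerivAt_id s).const_sub θ
    have h1 := ((hg' s).mul hs.sin).add ((hg s).mul hs.cos)
    refine h1.congr_deriv ?_
    ring
  have hmono : MonotoneOn W (Set.Icc 0 θ) := by
    refine monotoneOn_of_deriv_nonneg (convex_Icc 0 θ)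
      (fun s _ => (hW s).continuousAt.continuousWithinAt)
      (fun s _ => (hW s).differentiableAt.differentiableWithinAt) fun s hs => ?_
    rw [interior_Icc] at hs
    rw [(hW s).deriv]
    refine mul_nonneg ?_ (Real.sin_nonneg_of_nonneg_of_le_pi (by linarith [hs.2])
      (by linarith [hs.1, hθ.2]))
    have h1 := fderiv_fderiv_hom1 hf ⟨γ s, hγS s⟩ ⟨τ s, hτT s⟩ ⟨τ s, hτT s⟩
    exact h1 ▸ hpos _ _
  have h1 := hmono (Set.left_mem_Icc.2 hθ.1) (Set.right_mem_Icc.2 hθ.1) hθ.1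
  have hγθ : γ θ = (w : E n) := hw.symm
  simp only [W, sub_self, Real.sin_zero, Real.cos_zero, mul_zero, mul_one, zero_add, sub_zero] at h1
  rw [hγθ, hNdef, hom1_coe, ← hNdef] at h1
  have hγ00 : γ 0 = (x : E n) := by simp [γ]
  have hτ00 : τ 0 = (X : E n) := by simp [τ]
  rw [hγ00, hτ00] at h1
  refine le_trans (le_of_eq ?_) h1
  rw [hw, map_add, map_smul, map_smul, fderiv_apply_self hN (hom1_smul_pos f) (ne_zero_coe x)]
  simp only [smul_eq_mul]
  ring

theorem exists_body_of_formH_nonneg (hn : 1 ≤ n) {f : S n → ℝ} (hf : IsC2 f)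
    (hpos : ∀ (x : S n) (X : T x), 0 ≤ formH f x X X) :
    ∃ L : ConvexBody (E n), IsSupportFun L (hom1 f) := by
  have h1 := hom1_smul_pos f
  have hN := contDiffOn_hom1 hf
  obtain ⟨R, hR⟩ := (isCompact_range hf.continuous).bddAbove
  refine exists_body h1 (by simp [hom1]) (R := R)
    (fun x => by simpa using hR (Set.mem_range_self x))
    fun x => ⟨riesz n (fderiv ℝ (hom1 f) x), ?_, fun w => ?_⟩
  · rw [real_inner_comm, inner_riesz, fderiv_apply_self hN h1 (ne_zero_coe x)]
  · rw [real_inner_comm, inner_riesz]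
    by_cases hw : w = 0
    · simp [hw, hom1]
    obtain ⟨v, hv⟩ := exists_eq_smul hw
    have hr := norm_pos_iff.2 hw
    rw [hv, map_smul, h1 _ hr, smul_eq_mul, hom1_coe]
    exact mul_le_mul_of_nonneg_left (fderiv_hom1_le hn hf hpos x v) hr.le

/-! ### Bounds by the `C²` norm -/

theorem norm_grad_le (u : S n → ℝ) (x : S n) :
    ‖grad u x‖ ≤ ‖fderiv ℝ (ext0 u) (x : E n)‖ :=
  ContinuousLinearMap.opNorm_le_bound _ (norm_nonneg _) fun X => by
    simpa [grad] using (fderiv ℝ (ext0 u) (x : E n)).le_opNorm X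

set_option maxSynthPendingDepth 3 in
theorem norm_hess_le (u : S n → ℝ) (x : S n) :
    ‖hess u x‖ ≤ ‖fderiv ℝ (fderiv ℝ (ext0 u)) (x : E n)‖ :=
  ContinuousLinearMap.opNorm_le_bound₂ _ (norm_nonneg _) fun X Y => by
    simpa [hess] using (fderiv ℝ (fderiv ℝ (ext0 u)) (x : E n)).le_opNorm₂ X Y

theorem bddAbove_of_le {f g : S n → ℝ} (hg : Continuous g) (h : ∀ x, f x ≤ g x) :
    BddAbove (Set.range f) := by
  obtain ⟨R, hR⟩ := (isCompact_range hg).bddAbove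
  refine ⟨R, ?_⟩
  rintro _ ⟨x, rfl⟩
  exact (h x).trans (hR (Set.mem_range_self x))

set_option maxSynthPendingDepth 3 in
theorem c2Norm_bounds {u : S n → ℝ} (hu : IsC2 u) (x : S n) :
    |u x| ≤ c2Norm u ∧ ‖hess u x‖ ≤ c2Norm u := by
  have h0 := contDiffOn_ext0 hu
  have c1 : Continuous fun x : S n => ‖fderiv ℝ (ext0 u) (x : E n)‖ :=
    continuous_iff_continuousAt.2 fun x =>
      ((contDiffAt_fderiv_of_ne h0 (ne_zero_coe x)).continuousAt.comp
        continuous_subtype_val.continuousAt).norm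
  have c2 : Continuous fun x : S n => ‖fderiv ℝ (fderiv ℝ (ext0 u)) (x : E n)‖ :=
    continuous_iff_continuousAt.2 fun x =>
      ((((contDiffAt_fderiv_of_ne h0 (ne_zero_coe x)).fderiv_right (m := 0)
        (by norm_num)).continuousAt).comp (f := fun x : S n => (x : E n))
        continuous_subtype_val.continuousAt).norm
  have b0 := le_ciSup (bddAbove_of_le hu.continuous.abs fun x => le_rfl) x
  have b1 := le_ciSup (bddAbove_of_le c1 (norm_grad_le u)) x
  have b2 := le_ciSup (bddAbove_of_le c2 (norm_hess_le u)) x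
  have := abs_nonneg (u x)
  have := norm_nonneg (grad u x)
  have := norm_nonneg (hess u x)
  rw [c2Norm]
  constructor <;> linarith

/-- A constant `c` for which `u + c` and `u ^ 2 / 2 + c` are support functions, if `A` bounds the
`C²` norm of `u`. -/
def shift (A : ℝ) : ℝ := 2 * A + A ^ 2

set_option maxSynthPendingDepth 3 in
/-- The constant `shift (c2Norm u)` dominates the negative parts of the forms `H` of `u` and of
`u ^ 2 / 2`. -/
theorem exists_shifted_bodies (hn : 1 ≤ n) {u : S n → ℝ} (hu : IsC2 u) :
    ∃ L : ConvexBody (E n) × ConvexBody (E n),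
      IsSupportFun L.1 (hom1 fun x => u x ^ 2 / 2 + shift (c2Norm u)) ∧
      IsSupportFun L.2 (hom1 fun x => u x + shift (c2Norm u)) := by
  set A := c2Norm u
  have hess_ge : ∀ (x : S n) (X : T x), |hess u x X X| ≤ A * ‖X‖ ^ 2 := fun x X => by
    have h1 := (hess u x).le_opNorm₂ X X
    have h2 := mul_le_mul_of_nonneg_right (c2Norm_bounds hu x).2 (sq_nonneg ‖X‖)
    rw [Real.norm_eq_abs] at h1
    linarith
  have hA : 0 ≤ A := by
    obtain ⟨x⟩ := exists_sphere n
    exact (abs_nonneg _).trans (c2Norm_bounds hu x).1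
  obtain ⟨L₁, h₁⟩ := exists_body_of_formH_nonneg hn (hu.half_sq.add_const (shift A))
    fun x X => by
      rw [formH_add_const, formH, hess_half_sq hu, real_inner_self_eq_norm_sq]
      have h1 : |u x * hess u x X X| ≤ A * (A * ‖X‖ ^ 2) := by
        rw [abs_mul]
        exact mul_le_mul (c2Norm_bounds hu x).1 (hess_ge x X) (abs_nonneg _) hA
      have h2 := neg_abs_le (u x * hess u x X X)
      have h3 : 0 ≤ grad u x X * grad u x X := mul_self_nonneg _
      have h4 : 0 ≤ u x ^ 2 / 2 * ‖X‖ ^ 2 := by positivity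
      have h5 : 0 ≤ A * ‖X‖ ^ 2 := by positivity
      rw [shift]
      linarith
  obtain ⟨L₂, h₂⟩ := exists_body_of_formH_nonneg hn (hu.add_const (shift A))
    fun x X => by
      rw [formH_add_const, formH, real_inner_self_eq_norm_sq]
      have h1 := neg_abs_le (hess u x X X)
      have h2 := hess_ge x X
      have h3 := mul_le_mul_of_nonneg_right
        ((neg_le_neg (c2Norm_bounds hu x).1).trans (neg_abs_le _)) (sq_nonneg ‖X‖)
      have h4 : 0 ≤ A ^ 2 * ‖X‖ ^ 2 := by positivity
      rw [shift]
      linarith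
  exact ⟨(L₁, L₂), h₁, h₂⟩

/-! ### Density of smooth bodies -/

namespace IsSupportFun

variable {K L : ConvexBody (E n)} {N N' : E n → ℝ}

theorem exists_dist_le (hK : IsSupportFun K N) (hL : IsSupportFun L N') {δ : ℝ}
    (hδ : 0 ≤ δ) (h : ∀ x : S n, N x ≤ N' x + δ) {z : E n} (hz : z ∈ K) :
    ∃ z' ∈ L, dist z z' ≤ δ := by
  refine ⟨nearest L z, nearest_mem L z, ?_⟩
  rw [dist_eq_norm]
  by_cases h0 : z - nearest L z = 0
  · rwa [h0, norm_zero]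
  obtain ⟨x, hx⟩ := exists_eq_smul h0
  have hr := norm_pos_iff.2 h0
  have h1 := hL.inner_nearest z
  set p := nearest L z
  set r := ‖z - p‖
  rw [hx, hL.smul_pos hr, real_inner_smul_left] at h1
  have h2 := mul_left_cancel₀ hr.ne' h1
  have h3 := hK.le x z hz
  have h4 : ⟪(x : E n), z⟫_ℝ = ⟪(x : E n), p⟫_ℝ + r := by
    have : z = p + r • (x : E n) := by rw [← hx]; abel
    nth_rewrite 1 [this]
    rw [inner_add_right, real_inner_smul_right, real_inner_self_eq_norm_sq, norm_coe]
    ring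
  linarith [h x]

theorem dist_le (hK : IsSupportFun K N) (hL : IsSupportFun L N') {δ : ℝ} (hδ : 0 ≤ δ)
    (h : ∀ x : S n, |N x - N' x| ≤ δ) : dist K L ≤ δ :=
  Metric.hausdorffDist_le_of_mem_dist hδ
    (fun _ hz => hK.exists_dist_le hL hδ (fun x => by linarith [(abs_le.1 (h x)).2]) hz)
    (fun _ hz => hL.exists_dist_le hK hδ (fun x => by linarith [(abs_le.1 (h x)).1]) hz)

theorem mem_iff (hK : IsSupportFun K N) {z : E n} : z ∈ K ↔ ∀ w, ⟪w, z⟫_ℝ ≤ N w := by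
  refine ⟨fun hz w => hK.le w z hz, fun h => ?_⟩
  have h1 := h (z - nearest K z)
  rw [← hK.inner_nearest, ← sub_nonpos, ← inner_sub_right] at h1
  have h2 := inner_self_eq_zero.1 (le_antisymm h1 real_inner_self_nonneg)
  rw [sub_eq_zero.1 h2]
  exact nearest_mem K z

theorem isEven (hK : IsSupportFun K N) (h : ∀ y, N (-y) = N y) : IsEven K := fun z hz =>
  hK.mem_iff.2 fun w => by
    rw [inner_neg_right, ← inner_neg_left, ← h]
    exact hK.le _ z hz

end IsSupportFun

/-- A differentiable sublinear function is a support function. -/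
theorem exists_body_of_sublinear {N : E n → ℝ} (hN : ContDiffOn ℝ 2 N {0}ᶜ)
    (h1 : ∀ r > 0, ∀ y, N (r • y) = r * N y) (h0 : N 0 = 0)
    (hadd : ∀ y w, N (y + w) ≤ N y + N w) : ∃ L : ConvexBody (E n), IsSupportFun L N := by
  have hcont : Continuous fun x : S n => N x :=
    hN.continuousOn.comp_continuous continuous_subtype_val fun x => ne_zero_coe x
  obtain ⟨R, hR⟩ := (isCompact_range hcont).bddAbove
  refine exists_body h1 h0 (R := R) (fun x => hR (Set.mem_range_self x))
    fun x => ⟨riesz n (fderiv ℝ N x), ?_, fun w => ?_⟩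
  · rw [real_inner_comm, inner_riesz, fderiv_apply_self hN h1 (ne_zero_coe x)]
  · rw [real_inner_comm, inner_riesz]
    have hc : HasDerivAt (fun t : ℝ => (x : E n) + t • w) w 0 := by
      simpa using ((hasDerivAt_id (0 : ℝ)).smul_const w).const_add (x : E n)
    have hd : HasDerivAt (fun t : ℝ => N ((x : E n) + t • w)) (fderiv ℝ N x w) 0 := by
      have hf : HasFDerivAt N (fderiv ℝ N x) ((x : E n) + (0 : ℝ) • w) := by
        rw [zero_smul, add_zero]
        exact (differentiableAt_of_ne hN (ne_zero_coe x)).hasFDerivAt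
      exact hf.comp_hasDerivAt (0 : ℝ) hc
    have hs : Tendsto (slope (fun t : ℝ => N ((x : E n) + t • w)) 0) (𝓝[>] 0)
        (𝓝 (fderiv ℝ N x w)) :=
      hd.tendsto_slope.mono_left (nhdsWithin_mono 0 fun t ht => ne_of_gt ht)
    refine le_of_tendsto hs ?_
    filter_upwards [self_mem_nhdsWithin] with t ht
    have ht : 0 < t := ht
    rw [slope_def_field, sub_zero, div_le_iff₀ ht, zero_smul, add_zero]
    have h2 := hadd x (t • w)
    rw [h1 t ht] at h2
    linarith

/-- The closed unit ball, as a convex body. -/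
def unitBall (n : ℕ) : ConvexBody (E n) :=
  ⟨closedBall 0 1, convex_closedBall 0 1, isCompact_closedBall 0 1, ⟨0, by simp⟩⟩

theorem isSupportFun_unitBall : IsSupportFun (unitBall n) fun y => ‖y‖ where
  le y z hz := by
    have hz : ‖z‖ ≤ 1 := mem_closedBall_zero_iff.1 hz
    have := real_inner_le_norm y z
    nlinarith [norm_nonneg y]
  exists_eq y := by
    by_cases hy : y = 0
    · exact ⟨0, (mem_closedBall_zero_iff.2 (by simp) : (0 : E n) ∈ closedBall 0 1), by simp [hy]⟩
    · obtain ⟨x, hx⟩ := exists_eq_smul hy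
      refine ⟨x, (mem_closedBall_zero_iff.2 (by simp) : (x : E n) ∈ closedBall 0 1), ?_⟩
      nth_rewrite 1 [hx]
      rw [real_inner_smul_left, real_inner_self_eq_norm_sq, norm_coe]
      ring

/-- The function `y ↦ (∑_{v ∈ t} ⟪v, y⟫^{2m})^{1/(2m)}`. -/
def powerMean (t : Finset (E n)) (m : ℕ) (y : E n) : ℝ :=
  (∑ v ∈ t, ⟪v, y⟫_ℝ ^ (2 * m)) ^ (1 / ((2 * m : ℕ) : ℝ))

theorem sum_pow_nonneg (t : Finset (E n)) (m : ℕ) (y : E n) :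
    0 ≤ ∑ v ∈ t, ⟪v, y⟫_ℝ ^ (2 * m) :=
  Finset.sum_nonneg fun _ _ => (even_two_mul m).pow_nonneg _

theorem powerMean_add_le (t : Finset (E n)) {m : ℕ} (hm : 1 ≤ m) (y w : E n) :
    powerMean t m (y + w) ≤ powerMean t m y + powerMean t m w := by
  have h := Real.Lp_add_le t (fun v => ⟪v, y⟫_ℝ) (fun v => ⟪v, w⟫_ℝ) (p := ((2 * m : ℕ) : ℝ))
    (by exact_mod_cast (by omega : 1 ≤ 2 * m))
  unfold powerMean
  simpa only [Real.rpow_natCast, (even_two_mul m).pow_abs, ← inner_add_right] using h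

theorem powerMean_smul_pos (t : Finset (E n)) {m : ℕ} (hm : 1 ≤ m) (r : ℝ) (hr : r > 0) (y : E n) :
    powerMean t m (r • y) = r * powerMean t m y := by
  simp only [powerMean, real_inner_smul_right, mul_pow, ← Finset.mul_sum]
  rw [Real.mul_rpow (pow_nonneg hr.le _) (sum_pow_nonneg t m y), one_div,
    Real.pow_rpow_inv_natCast hr.le (by omega)]

theorem powerMean_neg (t : Finset (E n)) (m : ℕ) (y : E n) :
    powerMean t m (-y) = powerMean t m y := by
  simp only [powerMean, inner_neg_right, (even_two_mul m).neg_pow]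

theorem powerMean_zero (t : Finset (E n)) {m : ℕ} (hm : 1 ≤ m) : powerMean t m 0 = 0 := by
  have h2 : 2 * m ≠ 0 := by omega
  have h3 : (1 / ((2 * m : ℕ) : ℝ)) ≠ 0 := by positivity
  simp only [powerMean, inner_zero_right, zero_pow h2, Finset.sum_const_zero, Real.zero_rpow h3]

theorem le_powerMean {t : Finset (E n)} {m : ℕ} (hm : 1 ≤ m) {v : E n} (hv : v ∈ t) (y : E n) :
    |⟪v, y⟫_ℝ| ≤ powerMean t m y := by
  have h1 : ⟪v, y⟫_ℝ ^ (2 * m) ≤ ∑ v ∈ t, ⟪v, y⟫_ℝ ^ (2 * m) :=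
    Finset.single_le_sum (f := fun v => ⟪v, y⟫_ℝ ^ (2 * m))
      (fun _ _ => (even_two_mul m).pow_nonneg _) hv
  have h2 := Real.rpow_le_rpow ((even_two_mul m).pow_nonneg _) h1
    (by positivity : (0 : ℝ) ≤ 1 / ((2 * m : ℕ) : ℝ))
  rw [← (even_two_mul m).pow_abs, one_div,
    Real.pow_rpow_inv_natCast (abs_nonneg _) (by omega)] at h2
  rwa [powerMean, one_div]

theorem powerMean_le {t : Finset (E n)} {m : ℕ} (hm : 1 ≤ m) {y : E n} {a : ℝ} (ha : 0 ≤ a)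
    (h : ∀ v ∈ t, |⟪v, y⟫_ℝ| ≤ a) :
    powerMean t m y ≤ (t.card : ℝ) ^ (1 / ((2 * m : ℕ) : ℝ)) * a := by
  have h1 : ∑ v ∈ t, ⟪v, y⟫_ℝ ^ (2 * m) ≤ t.card * a ^ (2 * m) := by
    rw [← nsmul_eq_mul]
    refine Finset.sum_le_card_nsmul _ _ _ fun v hv => ?_
    rw [← (even_two_mul m).pow_abs]
    exact pow_le_pow_left₀ (abs_nonneg _) (h v hv) _
  have h2 := Real.rpow_le_rpow (sum_pow_nonneg t m y) h1
    (by positivity : (0 : ℝ) ≤ 1 / ((2 * m : ℕ) : ℝ))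
  rw [Real.mul_rpow (Nat.cast_nonneg _) (pow_nonneg ha _)] at h2
  nth_rewrite 3 [one_div] at h2
  rwa [Real.pow_rpow_inv_natCast ha (by omega)] at h2

theorem contDiffOn_powerMean {t : Finset (E n)} {m : ℕ} (hm : 1 ≤ m)
    (hpos : ∀ x : S n, 0 < powerMean t m x) : ContDiffOn ℝ 2 (powerMean t m) {0}ᶜ := by
  intro y hy
  have hy : y ≠ 0 := hy
  have h2 : (1 / ((2 * m : ℕ) : ℝ)) ≠ 0 := by positivity
  have hne : ∑ v ∈ t, ⟪v, y⟫_ℝ ^ (2 * m) ≠ 0 := by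
    intro h0
    obtain ⟨x, hx⟩ := exists_eq_smul hy
    have h1 : powerMean t m y = 0 := by rw [powerMean, h0, Real.zero_rpow h2]
    rw [hx, powerMean_smul_pos t hm _ (norm_pos_iff.2 hy)] at h1
    exact (mul_pos (norm_pos_iff.2 hy) (hpos x)).ne' h1
  refine ContDiffAt.contDiffWithinAt (ContDiffAt.rpow_const_of_ne ?_ hne)
  exact ContDiffAt.sum fun v _ => (contDiffAt_const.inner ℝ contDiffAt_id).pow _

open scoped Pointwise in
/-- Every origin-symmetric body is approximated by bodies with support function
`(∑ ⟪v, y⟫^{2m})^{1/(2m)} + δ|y|`, where `v` runs over a net of a parallel body. -/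
theorem exists_isSmoothPosEven_dist_le {K : ConvexBody (E n)} (hK : IsEven K) {δ : ℝ}
    (hδ : 0 < δ) : ∃ L : ConvexBody (E n), IsSmoothPosEven L ∧ dist L K ≤ 3 * δ := by
  have hS := isSupportFun_supp K
  set N := hom1 (supp K)
  obtain ⟨R, hR⟩ := exists_norm_le K
  obtain ⟨t', ht'sub, ht'fin, ht'cov⟩ := (K.isCompact.add
    (isCompact_closedBall (0 : E n) δ)).finite_cover_balls (half_pos hδ)
  set t := ht'fin.toFinset with ht
  have hupper : ∀ x : S n, ∀ v ∈ t, |⟪v, (x : E n)⟫_ℝ| ≤ N x + δ := by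
    intro x v hv
    obtain ⟨a, ha, b, hb, rfl⟩ := ht'sub ((ht'fin.mem_toFinset).1 hv)
    have h1 := hS.le x a ha
    have h2 := hS.le x (-a) (hK a ha)
    have h3 := abs_real_inner_le_norm (x : E n) b
    have hb : ‖b‖ ≤ δ := mem_closedBall_zero_iff.1 hb
    rw [inner_neg_right] at h2
    rw [norm_coe, one_mul] at h3
    rw [real_inner_comm, inner_add_right]
    have h4 := abs_le.1 h3
    rw [abs_le]
    constructor <;> linarith
  have hlower : ∀ x : S n, ∃ v ∈ t, N x + δ / 2 ≤ ⟪v, (x : E n)⟫_ℝ := by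
    intro x
    obtain ⟨z, hz, e⟩ := hS.exists_eq x
    have hmem : z + δ • (x : E n) ∈ (K : Set (E n)) + closedBall (0 : E n) δ :=
      Set.add_mem_add hz (by rw [mem_closedBall_zero_iff, norm_smul, norm_coe,
        Real.norm_of_nonneg hδ.le, mul_one])
    obtain ⟨v, hv, hvd⟩ := Set.mem_iUnion₂.1 (ht'cov hmem)
    refine ⟨v, (ht'fin.mem_toFinset).2 hv, ?_⟩
    rw [mem_ball, dist_eq_norm] at hvd
    have h1 := real_inner_le_norm (x : E n) (z + δ • (x : E n) - v)
    rw [inner_sub_right, inner_add_right, real_inner_smul_right, real_inner_self_eq_norm_sq, e,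
      norm_coe] at h1
    rw [real_inner_comm]
    linarith
  have hN0 : ∀ x : S n, 0 ≤ N x := by
    intro x
    obtain ⟨z, hz⟩ := K.nonempty
    have h1 := hS.le x z hz
    have h2 := hS.le x (-z) (hK z hz)
    rw [inner_neg_right] at h2
    linarith
  have hNR : ∀ x : S n, N x ≤ R := by
    intro x
    obtain ⟨z, hz, e⟩ := hS.exists_eq x
    have h1 := real_inner_le_norm (x : E n) z
    rw [norm_coe, one_mul, e] at h1
    exact h1.trans (hR z hz)
  have hcard : (t.card : ℝ) ≠ 0 := by
    obtain ⟨x⟩ := exists_sphere n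
    obtain ⟨v, hv, -⟩ := hlower x
    exact_mod_cast (Finset.card_pos.2 ⟨v, hv⟩).ne'
  -- a power `2m` for which the power mean is close to the maximum
  obtain ⟨m, hm, hmc⟩ : ∃ m : ℕ, 1 ≤ m ∧
      ((t.card : ℝ) ^ (1 / ((2 * m : ℕ) : ℝ)) - 1) * (R + δ) ≤ δ := by
    have h1 : Tendsto (fun m : ℕ => 1 / ((2 * m : ℕ) : ℝ)) atTop (𝓝 0) :=
      tendsto_const_nhds.div_atTop (tendsto_natCast_atTop_atTop.comp
        (tendsto_id.const_mul_atTop' two_pos))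
    have h2 : Tendsto (fun s : ℝ => ((t.card : ℝ) ^ s - 1) * (R + δ)) (𝓝 0) (𝓝 0) := by
      have hc : Continuous fun s : ℝ => ((t.card : ℝ) ^ s - 1) * (R + δ) :=
        ((Real.continuous_const_rpow hcard).sub continuous_const).mul continuous_const
      simpa using hc.tendsto 0
    exact (((eventually_ge_atTop 1).and ((h2.comp h1).eventually_le_const hδ))).exists
  have hlow : ∀ x : S n, N x + δ / 2 ≤ powerMean t m x := fun x => by
    obtain ⟨v, hv, h⟩ := hlower x
    exact h.trans ((le_abs_self _).trans (le_powerMean hm hv x))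
  have hup : ∀ x : S n, powerMean t m x ≤ N x + 2 * δ := fun x => by
    have h1 := powerMean_le hm (add_nonneg (hN0 x) hδ.le) (hupper x)
    have h2 : (1 : ℝ) ≤ (t.card : ℝ) ^ (1 / ((2 * m : ℕ) : ℝ)) :=
      Real.one_le_rpow (by
        have : t.card ≠ 0 := by exact_mod_cast hcard
        exact_mod_cast Nat.one_le_iff_ne_zero.2 this) (by positivity)
    have h3 := mul_le_mul_of_nonneg_left (add_le_add_left (hNR x) δ) (sub_nonneg.2 h2)
    linarith
  have hC2 := contDiffOn_powerMean hm fun x => (add_pos_of_nonneg_of_pos (hN0 x)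
    (half_pos hδ)).trans_le (hlow x)
  obtain ⟨L₀, hL₀⟩ := exists_body_of_sublinear hC2 (powerMean_smul_pos t hm)
    (powerMean_zero t hm) (powerMean_add_le t hm)
  have hL := isSupportFun_unitBall.smul_add hL₀ hδ.le
  have hsupp : supp (δ • unitBall n + L₀) = fun x => supp L₀ x + δ := by
    funext x
    rw [hL.supp_eq, hL₀.supp_eq, norm_coe]
    ring
  have hc₀ : IsC2 (supp L₀) := isC2_of_contDiffOn hC2 hL₀.supp_eq
  refine ⟨δ • unitBall n + L₀, ⟨hL.isEven fun y => ?_, ?_, fun x X hX => ?_⟩,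
    hL.dist_le hS (by positivity) fun x => ?_⟩
  · rw [norm_neg, powerMean_neg]
  · rw [hsupp]
    exact hc₀.add_const δ
  · rw [hsupp, formH_add_const, ← fderiv_fderiv_hom1 hc₀, ← inner_hessOp]
    have h1 := (isSupportFun_supp L₀).hessOp_nonneg (contDiffOn_hom1 hc₀) (ne_zero_coe x) X
    have h2 : 0 < ⟪X, X⟫_ℝ := real_inner_self_pos.2 hX
    have h3 := mul_pos hδ h2
    linarith
  · rw [norm_coe, abs_le]
    have := hlow x
    have := hup x
    constructor <;> linarith

theorem exists_tendsto_isSmoothPosEven {K : ConvexBody (E n)} (hK : IsEven K) :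
    ∃ Ki : ℕ → ConvexBody (E n), (∀ i, IsSmoothPosEven (Ki i)) ∧ Tendsto Ki atTop (𝓝 K) := by
  have h := fun i : ℕ => exists_isSmoothPosEven_dist_le hK
    (Nat.one_div_pos_of_nat (α := ℝ) (n := i))
  choose Ki hKi hd using h
  refine ⟨Ki, hKi, tendsto_iff_dist_tendsto_zero.2 ?_⟩
  refine squeeze_zero (fun i => dist_nonneg) hd ?_
  simpa using (tendsto_one_div_add_atTop_nhds_zero_nat (𝕜 := ℝ)).const_mul 3

/-! ### The extended measure -/

/-- A pointwise limit of the functionals of finite measures on `S^n` is the functional of a finite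
measure, by the Riesz–Markov–Kakutani theorem. -/
theorem exists_finiteMeasure_of_tendsto {μ : ℕ → FiniteMeasure (S n)} {Λ : (S n → ℝ) → ℝ}
    (h : ∀ φ : S n → ℝ, Continuous φ →
      Tendsto (fun i => ∫ x, φ x ∂(μ i : Measure (S n))) atTop (𝓝 (Λ φ))) :
    ∃ ν : FiniteMeasure (S n), ∀ φ : S n → ℝ, Continuous φ →
      ∫ x, φ x ∂(ν : Measure (S n)) = Λ φ := by
  have hint : ∀ (i : ℕ) (g : CompactlySupportedContinuousMap (S n) ℝ),
      Integrable g (μ i : Measure (S n)) := fun i g =>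
    g.continuous.integrable_of_hasCompactSupport g.hasCompactSupport
  let T : CompactlySupportedContinuousMap (S n) ℝ →ₚ[ℝ] ℝ :=
    { toFun := fun g => Λ g
      map_add' := fun g g' => tendsto_nhds_unique (h _ (g + g').continuous) (by
        refine ((h g g.continuous).add (h g' g'.continuous)).congr fun i => ?_
        exact (integral_add (hint i g) (hint i g')).symm)
      map_smul' := fun c g => tendsto_nhds_unique (h _ (c • g).continuous) (by
        refine ((h g g.continuous).const_smul c).congr fun i => ?_
        exact (integral_smul c g).symm)
      monotone' := fun g g' hgg' => le_of_tendsto_of_tendsto' (h g g.continuous)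
        (h g' g'.continuous) fun i => integral_mono (hint i g) (hint i g') hgg' }
  have hfin : IsFiniteMeasure (RealRMK.rieszMeasure T) := inferInstance
  refine ⟨⟨RealRMK.rieszMeasure T, hfin⟩, fun φ hφ => ?_⟩
  exact RealRMK.integral_rieszMeasure T
    ⟨⟨φ, hφ⟩, HasCompactSupport.of_compactSpace _⟩

/-- Two convex bodies with support functions `u ^ 2 / 2 + c` and `u + c`, where
`c = shift (c2Norm u)`. They exist if `u` is of class `C²`. -/
def shiftedBodies (u : S n → ℝ) : ConvexBody (E n) × ConvexBody (E n) :=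
  Classical.epsilon fun L : ConvexBody (E n) × ConvexBody (E n) =>
    IsSupportFun L.1 (hom1 fun x => u x ^ 2 / 2 + shift (c2Norm u)) ∧
    IsSupportFun L.2 (hom1 fun x => u x + shift (c2Norm u))

theorem shiftedBodies_spec (hn : 1 ≤ n) {u : S n → ℝ} (hu : IsC2 u) :
    IsSupportFun (shiftedBodies u).1 (hom1 fun x => u x ^ 2 / 2 + shift (c2Norm u)) ∧
    IsSupportFun (shiftedBodies u).2 (hom1 fun x => u x + shift (c2Norm u)) :=
  Classical.epsilon_spec (exists_shifted_bodies hn hu)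

/-- The integral of `φ` against the measure `𝔪_{K,u}`, for any convex body `K`. -/
def extendedIntegral (K : ConvexBody (E n)) (u φ : S n → ℝ) : ℝ :=
  cofactorFunctional K (shiftedBodies u).1 (shiftedBodies u).2 (shift (c2Norm u)) u φ

/-- The measure `μ` represents the functional `extendedIntegral K u`. -/
def Represents (K : ConvexBody (E n)) (u : S n → ℝ) (μ : FiniteMeasure (S n)) : Prop :=
  ∀ φ : S n → ℝ, Continuous φ → ∫ x, φ x ∂(μ : Measure (S n)) = extendedIntegral K u φ

open Classical in
/-- The measure `𝔪_{K,u}`: the measure representing `extendedIntegral K u`, and zero if there is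
none. By `exists_represents`, it exists for every origin-symmetric `K` and `u` of class `C²`. -/
def extendedMeasure (K : ConvexBody (E n)) (u : S n → ℝ) : FiniteMeasure (S n) :=
  if h : ∃ μ, Represents K u μ then h.choose else 0

theorem represents_extendedMeasure {K : ConvexBody (E n)} {u : S n → ℝ}
    (h : ∃ μ, Represents K u μ) : Represents K u (extendedMeasure K u) := by
  rw [extendedMeasure, dif_pos h]
  exact h.choose_spec

theorem Represents.unique {K : ConvexBody (E n)} {u : S n → ℝ} {μ ν : FiniteMeasure (S n)}
    (hμ : Represents K u μ) (hν : Represents K u ν) : μ = ν :=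
  Subtype.ext (ext_of_forall_integral_eq_of_IsFiniteMeasure (μ := (μ : Measure (S n)))
    (ν := (ν : Measure (S n))) fun φ =>
      (hμ φ φ.continuous).trans (hν φ φ.continuous).symm)

theorem represents_cofactorMeasure (hn : 1 ≤ n) {K : ConvexBody (E n)} {u : S n → ℝ}
    (hK : IsC2 (supp K)) (hu : IsC2 u) :
    Represents K u ⟨cofactorMeasure K u, isFiniteMeasure_cofactorMeasure hn hK hu⟩ :=
  fun _ hφ => integral_cofactorMeasure hn hK hu (shiftedBodies_spec hn hu).1
    (shiftedBodies_spec hn hu).2 hφ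

theorem exists_represents_of_tendsto (hn : 1 ≤ n) {u : S n → ℝ} (hu : IsC2 u)
    {Ki : ℕ → ConvexBody (E n)} {K : ConvexBody (E n)} (hKi : ∀ i, IsC2 (supp (Ki i)))
    (h : Tendsto Ki atTop (𝓝 K)) : ∃ μ, Represents K u μ := by
  refine exists_finiteMeasure_of_tendsto
    (μ := fun i => ⟨cofactorMeasure (Ki i) u, isFiniteMeasure_cofactorMeasure hn (hKi i) hu⟩)
    fun φ hφ => ?_
  refine (tendsto_cofactorFunctional h _ _ _ hu.continuous hφ).congr fun i => ?_
  exact (represents_cofactorMeasure hn (hKi i) hu φ hφ).symm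

theorem exists_represents (hn : 1 ≤ n) {K : ConvexBody (E n)} (hK : IsEven K) {u : S n → ℝ}
    (hu : IsC2 u) : ∃ μ, Represents K u μ := by
  obtain ⟨Ki, hKi, h⟩ := exists_tendsto_isSmoothPosEven hK
  exact exists_represents_of_tendsto hn hu (fun i => (hKi i).c2) h

theorem extendedMeasure_eq_cofactorMeasure (hn : 1 ≤ n) {K : ConvexBody (E n)} {u : S n → ℝ}
    (hK : IsC2 (supp K)) (hu : IsC2 u) :
    (extendedMeasure K u : Measure (S n)) = cofactorMeasure K u :=
  congrArg Subtype.val ((represents_extendedMeasure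
    ⟨_, represents_cofactorMeasure hn hK hu⟩).unique (represents_cofactorMeasure hn hK hu))

theorem tendsto_extendedMeasure (hn : 1 ≤ n) {u : S n → ℝ} (hu : IsC2 u)
    {Ki : ℕ → ConvexBody (E n)} {K : ConvexBody (E n)} (hKi : ∀ i, IsC2 (supp (Ki i)))
    (h : Tendsto Ki atTop (𝓝 K)) :
    Tendsto (fun i => extendedMeasure (Ki i) u) atTop (𝓝 (extendedMeasure K u)) := by
  rw [FiniteMeasure.tendsto_iff_forall_integral_tendsto]
  intro φ
  have h1 := fun i => represents_extendedMeasure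
    ⟨_, represents_cofactorMeasure hn (hKi i) hu⟩ φ φ.continuous
  have h2 := represents_extendedMeasure (exists_represents_of_tendsto hn hu hKi h) φ φ.continuous
  rw [h2]
  simp only [h1]
  exact tendsto_cofactorFunctional h _ _ _ hu.continuous φ.continuous

/-! ### The bound for the total mass -/

theorem abs_tent_mul_le {ξ : E n → ℝ} {C : ℝ} (hC : 0 ≤ C)
    (h : ∀ y ≠ 0, ‖y‖ ≤ 3 → |ξ y| ≤ C) (y : E n) : |tent ‖y‖ * ξ y| ≤ C := by
  by_cases h0 : y = 0
  · rw [h0, tent_of_le (by simp), zero_mul, abs_zero]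
    exact hC
  rcases le_total ‖y‖ 3 with h3 | h3
  · rw [abs_mul, abs_of_nonneg (tent_nonneg _)]
    exact (mul_le_of_le_one_left (abs_nonneg _) (tent_le_one _)).trans (h y h0 h3)
  · rw [tent_mul_eq_zero ξ h3, abs_zero]
    exact hC

theorem abs_supp_le {K : ConvexBody (E n)} {B : ℝ} (h : supNorm (supp K) ≤ B) (x : S n) :
    |supp K x| ≤ B := by
  obtain ⟨R, hR⟩ := exists_norm_le K
  refine le_trans (le_ciSup (f := fun x => |supp K x|) ⟨R, ?_⟩ x) h
  rintro _ ⟨x, rfl⟩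
  obtain ⟨z, hz, e⟩ := (isSupportFun_supp K).exists_eq x
  rw [hom1_coe] at e
  simp only
  rw [← e]
  refine (abs_real_inner_le_norm _ _).trans ?_
  rw [norm_coe, one_mul]
  exact hR z hz

theorem abs_sum_normalIntegral_le {K L : ConvexBody (E n)} {R R' C : ℝ}
    (hK : ∀ z ∈ K, ‖z‖ ≤ R) (hL : ∀ z ∈ L, ‖z‖ ≤ R') {ξ : E n → ℝ} (hC : 0 ≤ C)
    (h : ∀ y ≠ 0, ‖y‖ ≤ 3 → |ξ y| ≤ C) :
    |∑ j ∈ Finset.range (n + 1), weight n j *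
        normalIntegral ((j : ℝ) • K + L) (fun y => tent ‖y‖ * ξ y)| ≤
      (∑ j ∈ Finset.range (n + 1), |weight n j|) *
        (C * volume.real (closedBall (0 : E n) (n * R + R' + 3))) := by
  rw [Finset.sum_mul]
  refine (Finset.abs_sum_le_sum_abs _ _).trans (Finset.sum_le_sum fun j hj => ?_)
  rw [abs_mul]
  refine mul_le_mul_of_nonneg_left ?_ (abs_nonneg _)
  refine abs_normalIntegral_le (fun z hz => ?_) (abs_tent_mul_le hC h)
    fun y hy => tent_mul_eq_zero ξ hy
  obtain ⟨a, ha, b, hb, rfl⟩ := mem_smul_add.1 hz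
  have hj : (j : ℝ) ≤ n := by exact_mod_cast Nat.lt_succ_iff.1 (Finset.mem_range.1 hj)
  refine (norm_add_le _ _).trans (add_le_add ?_ (hL b hb))
  rw [norm_smul, Real.norm_natCast]
  exact mul_le_mul hj (hK a ha) (norm_nonneg _) (Nat.cast_nonneg n)

theorem abs_extendedIntegral_one_le (hn : 1 ≤ n) (A B : ℝ) : ∃ C : ℝ, 0 ≤ C ∧
    ∀ (K : ConvexBody (E n)) (u : S n → ℝ), IsC2 u → c2Norm u ≤ A → supNorm (supp K) ≤ B →
      |extendedIntegral K u fun _ => 1| ≤ C := by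
  set D := 3 + 3 * A + A ^ 2 / 2 + (shift A + 3) * (1 + A) with hD
  set R' := A ^ 2 / 2 + shift A + A with hR'
  set V := volume.real (closedBall (0 : E n) (n * max B 0 + R' + 3)) with hV
  set W := ∑ j ∈ Finset.range (n + 1), |weight n j|
  refine ⟨|3 * (W * (D * V)) / radialMass n|, abs_nonneg _, fun K u hu hA hB => ?_⟩
  obtain ⟨x₀⟩ := exists_sphere n
  have hu1 : ∀ x, |u x| ≤ A := fun x => (c2Norm_bounds hu x).1.trans hA
  have hc0 : 0 ≤ c2Norm u := (abs_nonneg _).trans (c2Norm_bounds hu x₀).1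
  have hA0 : 0 ≤ A := hc0.trans hA
  set c := shift (c2Norm u) with hc
  have hcs : c ≤ shift A := by
    rw [hc, shift, shift]
    nlinarith
  have hc0 : 0 ≤ c := by rw [hc, shift]; positivity
  have hs0 : 0 ≤ shift A := hc0.trans hcs
  have hsq : ∀ x, u x ^ 2 ≤ A ^ 2 := fun x => sq_le_sq' (abs_le.1 (hu1 x)).1 (abs_le.1 (hu1 x)).2
  have hR'0 : 0 ≤ R' := by positivity
  have hD0 : 0 ≤ (shift A + 3) * (1 + A) := by positivity
  have hD1 : 0 ≤ A ^ 2 / 2 := by positivity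
  have hK : ∀ z ∈ K, ‖z‖ ≤ max B 0 := norm_le_of_isSupportFun (isSupportFun_supp K)
    (le_max_right _ _) fun x => by
      rw [hom1_coe]
      exact ((le_abs_self _).trans (abs_supp_le hB x)).trans (le_max_left _ _)
  obtain ⟨h₁, h₂⟩ := shiftedBodies_spec hn hu
  have hL₁ : ∀ z ∈ (shiftedBodies u).1, ‖z‖ ≤ R' := norm_le_of_isSupportFun h₁ hR'0 fun x => by
    rw [hom1_coe]
    linarith [hsq x]
  have hL₂ : ∀ z ∈ (shiftedBodies u).2, ‖z‖ ≤ R' := norm_le_of_isSupportFun h₂ hR'0 fun x => by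
    rw [hom1_coe]
    linarith [(abs_le.1 (hu1 x)).2]
  have hL₀ : ∀ z ∈ (0 : ConvexBody (E n)), ‖z‖ ≤ R' :=
    norm_le_of_isSupportFun IsSupportFun.zero hR'0 fun _ => hR'0
  have e0 : ∀ y : E n, y ≠ 0 → ext0 (fun _ : S n => (1 : ℝ)) y = 1 := fun y hy => by simp [ext0, hy]
  have eu : ∀ y : E n, y ≠ 0 → |ext0 u y| ≤ A := fun y hy => by
    obtain ⟨x, hx⟩ := exists_eq_smul hy
    rw [ext0_eq (norm_pos_iff.2 hy) hx]
    exact hu1 x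
  have hDn : 0 ≤ D := by positivity
  have b₁ := abs_sum_normalIntegral_le hK hL₁
    (ξ := fun y => ‖y‖ * ext0 (fun _ : S n => (1 : ℝ)) y) hDn fun y hy hy3 => by
      rw [e0 y hy, mul_one, abs_norm]
      linarith
  have b₂ := abs_sum_normalIntegral_le hK hL₂
    (ξ := fun y => ‖y‖ * ext0 (fun _ : S n => (1 : ℝ)) y * ext0 u y) hDn fun y hy hy3 => by
      rw [e0 y hy, mul_one, abs_mul, abs_norm]
      have := mul_le_mul hy3 (eu y hy) (abs_nonneg _) (by norm_num)
      linarith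
  have b₀ := abs_sum_normalIntegral_le hK hL₀
    (ξ := fun y => ext0 (fun _ : S n => (1 : ℝ)) y *
      (ext0 u y ^ 2 / 2 - (c + ‖y‖) * (1 - ext0 u y))) hDn fun y hy hy3 => by
      rw [e0 y hy, one_mul]
      have h1 := abs_le.1 (eu y hy)
      have h2 : |(c + ‖y‖) * (1 - ext0 u y)| ≤ (shift A + 3) * (1 + A) := by
        rw [abs_mul, abs_of_nonneg (by positivity)]
        refine mul_le_mul (add_le_add hcs hy3) (abs_le.2 ⟨?_, ?_⟩) (abs_nonneg _) (by positivity)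
        · linarith
        · linarith
      have h3 : ext0 u y ^ 2 ≤ A ^ 2 := sq_le_sq' h1.1 h1.2
      have h4 := sq_nonneg (ext0 u y)
      have h5 := abs_le.1 h2
      rw [abs_le]
      constructor <;> linarith
  rw [extendedIntegral, cofactorFunctional, abs_div, abs_div]
  refine div_le_div_of_nonneg_right ((abs_add_le _ _).trans ?_) (abs_nonneg _)
  refine le_trans ?_ (le_abs_self _)
  refine (add_le_add ((norm_sub_le (_ : ℝ) _).trans (add_le_add b₁ b₂)) b₀).trans (le_of_eq ?_)
  ring

end ConvexSphere

end

open ConvexSphere in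
theorem theorem4p1 (n : ℕ) (hn : 1 ≤ n) :
    ∃ 𝔪 : ConvexBody (E n) → (S n → ℝ) → FiniteMeasure (S n),
      -- if the support function is `C²`, then `𝔪 K u` is `U^{ij} u_i u_j dS`
      (∀ (K : ConvexBody (E n)) (u : S n → ℝ), IsEven K → IsC2 (supp K) → IsC2 u →
        (𝔪 K u : Measure (S n)) = cofactorMeasure K u) ∧
      -- weak convergence
      (∀ u : S n → ℝ, IsC2 u → ∀ (Ki : ℕ → ConvexBody (E n)) (K : ConvexBody (E n)),
        (∀ i, IsSmoothPosEven (Ki i)) → Tendsto Ki atTop (𝓝 K) →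
          Tendsto (fun i => 𝔪 (Ki i) u) atTop (𝓝 (𝔪 K u))) ∧
      -- every origin-symmetric body is such a limit, so that `𝔪 K u` is determined by the above
      (∀ K : ConvexBody (E n), IsEven K → ∃ Ki : ℕ → ConvexBody (E n),
        (∀ i, IsSmoothPosEven (Ki i)) ∧ Tendsto Ki atTop (𝓝 K)) ∧
      -- the total mass is bounded in terms of `n`, `‖u‖_{C²}` and `‖h_K‖_{L^∞}`
      (∀ A B : ℝ, ∃ C : ℝ, ∀ (K : ConvexBody (E n)) (u : S n → ℝ), IsEven K → IsC2 u →
        c2Norm u ≤ A → supNorm (supp K) ≤ B → ((𝔪 K u).mass : ℝ) ≤ C) := by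
  refine ⟨extendedMeasure, fun K u _ hK hu => extendedMeasure_eq_cofactorMeasure hn hK hu,
    fun u hu Ki K hKi h => tendsto_extendedMeasure hn hu (fun i => (hKi i).c2) h,
    fun K hK => exists_tendsto_isSmoothPosEven hK, fun A B => ?_⟩
  obtain ⟨C, -, h⟩ := abs_extendedIntegral_one_le hn A B
  refine ⟨C, fun K u hK hu hA hB => ?_⟩
  have h1 := represents_extendedMeasure (exists_represents hn hK hu) (fun _ => 1) continuous_const
  have h2 : ((extendedMeasure K u).mass : ℝ) =
      ∫ _, (1 : ℝ) ∂(extendedMeasure K u : Measure (S n)) := by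
    rw [integral_const, smul_eq_mul, mul_one]
    rfl
  rw [h2, h1]
  exact (le_abs_self _).trans (h K u hu hA hB)
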